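/- Let $n\ge 1$ and let $\mathbb{R}^n$ carry the $\ell^\infty$ metric $|x-y|$. Let $\mu$ be a Borel measure on $\mathbb{R}^n$ such that $\mu(B(x,r))\le\lambda(x,r)$ for all $x\in\mathbb{R}^n$, $r>0$, where $\lambda\colon\mathbb{R}^n\times(0,\infty)\to(0,\infty)$ is a function for which $r\mapsto\lambda(x,r)$ is non-decreasing and $\lambda(x,2r)\le C_\lambda\lambda(x,r)$ for all $x\in\mathbb{R}^n$ and $r>0$. Let $\alpha>0$, and let $s_t(x,y)$, $t>0$, $x,y\in\mathbb{R}^n$, be real or complex kernels, Borel measurable in $(t,x,y)$, such that for some constant $K$ $$|s_t(x,y)|\le K\,\frac{t^{\alpha}}{t^{\alpha}\lambda(x,t)+|x-y|^{\alpha}\lambda(x,|x-y|)}$$ for all $x,y\in\mathbb{R}^n$ and $t>0$, and $$|s_t(x,y)-s_t(x,z)|\le K\,\frac{|y-z|^{\alpha}}{t^{\alpha}\lambda(x,t)+|x-y|^{\alpha}\lambda(x,|x-y|)}$$ whenever $|y-z|<t/2$ (for $x=y$ the second summand of the denominators is read as $0$). Put $$\theta_tf(x)=\int_{\mathbb{R}^n}s_t(x,y)f(y)\,d\mu(y),\qquad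 x\in\mathbb{R}^n,\ t>0.$$ For a cube $Q\subset\mathbb{R}^n$ (closed, with sides parallel to the axes) of sidelength $\ell(Q)>0$ let $\widehat Q=Q\times(0,\ell(Q))$. Suppose that there is a constant $T$ such that $$\iint_{\widehat Q}|\theta_t\chi_Q(x)|^2\,d\mu(x)\,\frac{dt}{t}\le T\,\mu(Q)\qquad\text{for every cube }Q\subset\mathbb{R}^n .$$ Then for every $f\in L^2(\mu)$ the integral defining $\theta_tf(x)$ converges absolutely for all $x\in\mathbb{R}^n$ and $t>0$, and $$\iint_{\mathbb{R}^n\times(0,\infty)}|\theta_tf(x)|^2\,d\mu(x)\,\frac{dt}{t}\le C\,\|f\|_{L^2(\mu)}^2,$$ where the constant $C$ depends only on $n$, $\alpha$, $C_\lambda$, $K$ and $T$. -/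

import Mathlib

open MeasureTheory
open scoped ENNReal NNReal

namespace SquareFunction

/-- `ℝⁿ` with the `ℓ^∞` metric: the norm and the distance on `Fin n → ℝ` are the sup ones. -/
abbrev Space (n : ℕ) : Type := Fin n → ℝ

/-- The (closed) cube with centre `c` and sidelength `ℓ`; in the `ℓ^∞` metric this is the closed
ball of radius `ℓ / 2`. -/
def cube {n : ℕ} (c : Space n) (ℓ : ℝ) : Set (Space n) := Metric.closedBall c (ℓ / 2)

/-- `μ` is an upper doubling measure with dominating function `lam` and doubling constant `Cl`.
Only the values `lam x r` with `r > 0` matter. -/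
structure IsUpperDoubling {n : ℕ} (μ : Measure (Space n)) (lam : Space n → ℝ → ℝ) (Cl : ℝ) :
    Prop where
  pos : ∀ x r, 0 < r → 0 < lam x r
  mono : ∀ x, MonotoneOn (lam x) (Set.Ioi 0)
  doubling : ∀ x r, 0 < r → lam x (2 * r) ≤ Cl * lam x r
  measure_ball_le : ∀ x r, 0 < r → μ (Metric.ball x r) ≤ ENNReal.ofReal (lam x r)

/-- The denominator `t^α lam(x,t) + |x-y|^α lam(x,|x-y|)` of the kernel estimates.
For `x = y` and `α > 0` the second summand is `0`, whatever the value `lam x 0`. -/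
noncomputable def kernelDenom {n : ℕ} (lam : Space n → ℝ → ℝ) (α t : ℝ) (x y : Space n) : ℝ :=
  t ^ α * lam x t + ‖x - y‖ ^ α * lam x ‖x - y‖

/-- The family of kernels `s t`, `t > 0`, is (jointly Borel) measurable and satisfies the size and
the smoothness estimate with exponent `α` and constant `K`.
Only the values `s t x y` with `t > 0` matter. -/
structure IsSquareKernel {n : ℕ} {𝕜 : Type*} [RCLike 𝕜] (lam : Space n → ℝ → ℝ) (α K : ℝ)
    (s : ℝ → Space n → Space n → 𝕜) : Prop where
  measurable : Measurable fun p : Set.Ioi (0 : ℝ) × Space n × Space n => s p.1 p.2.1 p.2.2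
  size : ∀ t, 0 < t → ∀ x y, ‖s t x y‖ ≤ K * (t ^ α / kernelDenom lam α t x y)
  smooth : ∀ t, 0 < t → ∀ x y z, ‖y - z‖ < t / 2 →
    ‖s t x y - s t x z‖ ≤ K * (‖y - z‖ ^ α / kernelDenom lam α t x y)

/-- `θ_t f (x) = ∫ s_t(x,y) f(y) dμ(y)`. -/
noncomputable def theta {n : ℕ} {𝕜 : Type*} [RCLike 𝕜] (μ : Measure (Space n))
    (s : ℝ → Space n → Space n → 𝕜) (t : ℝ) (f : Space n → 𝕜) (x : Space n) : 𝕜 :=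
  ∫ y, s t x y * f y ∂μ

/-- `∬_{A × I} |θ_t f(x)|² dμ(x) dt/t`, as an element of `[0, ∞]`. -/
noncomputable def squareIntegral {n : ℕ} {𝕜 : Type*} [RCLike 𝕜] (μ : Measure (Space n))
    (s : ℝ → Space n → Space n → 𝕜) (A : Set (Space n)) (I : Set ℝ) (f : Space n → 𝕜) : ℝ≥0∞ :=
  ∫⁻ t in I, (∫⁻ x in A, ‖theta μ s t f x‖ₑ ^ 2 ∂μ) * ENNReal.ofReal (1 / t)

end SquareFunction

/-!
The estimate is proved on a bounded range of scales `δ 2^k`, `k ≤ N`, with a constant that does not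
depend on the range. A grid of half-open dyadic cubes with a random shift is used to decompose `f`
into martingale differences. At the scale `δ 2^k` a point is good if it is far, relative to the
sizes of the cubes, from the boundaries of the cubes of generations `k, …, N` containing it; every
point is good with probability at least `1/2`, so it suffices to estimate the square function on the
good points for a fixed shift.

There `θ_t` maps the `j`-th martingale difference to a function whose `L²` norm decays geometrically
in `|j - k|`: for small `j` by the smoothness of the kernel and the vanishing mean of the
difference, for large `j` by the size of the kernel and the distance to the boundary, Schur's test
turning both into `L²` bounds. What remains is the paraproduct, the average of `f` over the cube of
generation `k` times `θ_t 1`. The testing condition shows that `|θ_t 1|²` satisfies a Carleson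
packing condition on the good points, and the Carleson embedding theorem, proved with the Bellman
function `4 g² / (1 + M)`, bounds the paraproduct.
-/

namespace SquareFunction

section LIntegral

variable {X Y 𝕜 : Type*} [MeasurableSpace X] [MeasurableSpace Y] [RCLike 𝕜] {μ : Measure X}
  {ν : Measure Y}

theorem ennreal_add_sq_le (a b : ℝ≥0∞) : (a + b) ^ 2 ≤ 2 * (a ^ 2 + b ^ 2) := by
  have h := ENNReal.rpow_add_le_mul_rpow_add_rpow a b one_le_two
  norm_num at h
  exact h

theorem eLpNorm_two_sq (g : X → 𝕜) : eLpNorm g 2 μ ^ 2 = ∫⁻ x, ‖g x‖ₑ ^ 2 ∂μ := by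
  simpa using eLpNorm_nnreal_pow_eq_lintegral (f := g) (μ := μ) (p := 2) two_ne_zero

theorem memLp_two_iff_lintegral_lt_top {g : X → 𝕜} (hg : AEStronglyMeasurable g μ) :
    MemLp g 2 μ ↔ ∫⁻ x, ‖g x‖ₑ ^ 2 ∂μ < ∞ := by
  rw [← eLpNorm_two_sq, ENNReal.pow_lt_top_iff, MemLp]
  simp [hg]

theorem lintegral_enorm_sq_lt_top {g : X → 𝕜} (hg : MemLp g 2 μ) : ∫⁻ x, ‖g x‖ₑ ^ 2 ∂μ < ∞ :=
  (memLp_two_iff_lintegral_lt_top hg.aestronglyMeasurable).1 hg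

theorem lintegral_enorm_sq_eq_ofReal {g : X → 𝕜} (hg : MemLp g 2 μ) :
    ∫⁻ x, ‖g x‖ₑ ^ 2 ∂μ = ENNReal.ofReal (∫ x, ‖g x‖ ^ 2 ∂μ) := by
  rw [ofReal_integral_eq_lintegral_ofReal
    ((memLp_two_iff_integrable_sq_norm hg.aestronglyMeasurable).1 hg)
    (Filter.Eventually.of_forall fun x => by positivity)]
  simp only [ENNReal.ofReal_pow (norm_nonneg _), ofReal_norm]

theorem sq_lintegral_mul_le {f w : X → ℝ≥0∞} (hw : AEMeasurable w μ) (hf : AEMeasurable f μ) :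
    (∫⁻ x, w x * f x ∂μ) ^ 2 ≤ (∫⁻ x, w x ∂μ) * ∫⁻ x, w x * f x ^ 2 ∂μ := by
  have mul_self_sqrt (a : ℝ≥0∞) : a ^ (1 / 2 : ℝ) * a ^ (1 / 2 : ℝ) = a := by
    rw [← ENNReal.rpow_add_of_nonneg _ _ (by norm_num) (by norm_num)]; norm_num
  have rpow_two_sqrt (a : ℝ≥0∞) : (a ^ (1 / 2 : ℝ)) ^ (2 : ℝ) = a := by
    rw [← ENNReal.rpow_mul]; norm_num
  have sq_sqrt (a : ℝ≥0∞) : (a ^ (1 / 2 : ℝ)) ^ 2 = a := by rw [sq, mul_self_sqrt]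
  have holder := ENNReal.lintegral_mul_le_Lp_mul_Lq μ Real.HolderConjugate.two_two
    (f := fun x => w x ^ (1 / 2 : ℝ)) (g := fun x => w x ^ (1 / 2 : ℝ) * f x)
    (hw.pow_const _) ((hw.pow_const _).mul hf)
  simp only [Pi.mul_apply, ← mul_assoc, mul_self_sqrt, rpow_two_sqrt,
    ENNReal.mul_rpow_of_nonneg _ _ (zero_le_two : (0 : ℝ) ≤ 2)] at holder
  simpa only [mul_pow, sq_sqrt, ENNReal.rpow_two] using pow_le_pow_left' holder 2

theorem sq_lintegral_le_lintegral_mul_lintegral_sq_mul_inv {f w : X → ℝ≥0∞}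
    (hw : AEMeasurable w μ) (hf : AEMeasurable f μ) (h0 : ∀ x, w x ≠ 0) (htop : ∀ x, w x ≠ ∞) :
    (∫⁻ x, f x ∂μ) ^ 2 ≤ (∫⁻ x, w x ∂μ) * ∫⁻ x, f x ^ 2 * (w x)⁻¹ ∂μ := by
  have cancel (x : X) : w x * (f x * (w x)⁻¹) = f x := by
    rw [mul_left_comm, ENNReal.mul_inv_cancel (h0 x) (htop x), mul_one]
  have cancel_sq (x : X) : w x * (f x * (w x)⁻¹) ^ 2 = f x ^ 2 * (w x)⁻¹ := by
    rw [sq, ← mul_assoc, cancel, sq, mul_assoc]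
  simpa only [cancel, cancel_sq] using
    sq_lintegral_mul_le (f := fun x => f x * (w x)⁻¹) hw (hf.mul hw.inv)

/-- Schur's test. -/
theorem lintegral_sq_lintegral_mul_le [SFinite μ] [SFinite ν] {k : X → Y → ℝ≥0∞}
    (hk : Measurable (Function.uncurry k)) {A : ℝ≥0∞} (hy : ∀ x, ∫⁻ y, k x y ∂ν ≤ A)
    (hx : ∀ y, ∫⁻ x, k x y ∂μ ≤ A) {g : Y → ℝ≥0∞} (hg : Measurable g) :
    ∫⁻ x, (∫⁻ y, k x y * g y ∂ν) ^ 2 ∂μ ≤ A ^ 2 * ∫⁻ y, g y ^ 2 ∂ν := by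
  have hm : Measurable (Function.uncurry fun x y => k x y * g y ^ 2) :=
    hk.mul ((hg.comp measurable_snd).pow_const 2)
  calc ∫⁻ x, (∫⁻ y, k x y * g y ∂ν) ^ 2 ∂μ
      ≤ ∫⁻ x, A * ∫⁻ y, k x y * g y ^ 2 ∂ν ∂μ := by
        refine lintegral_mono fun x => ?_
        refine (sq_lintegral_mul_le hk.of_uncurry_left.aemeasurable hg.aemeasurable).trans ?_
        gcongr
        exact hy x
    _ = A * ∫⁻ y, (∫⁻ x, k x y ∂μ) * g y ^ 2 ∂ν := by
        rw [lintegral_const_mul _ hm.lintegral_prod_right, lintegral_lintegral_swap hm.aemeasurable]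
        simp only [lintegral_mul_const _ hk.of_uncurry_right]
    _ ≤ A * ∫⁻ y, A * g y ^ 2 ∂ν := by
        gcongr with y
        exact hx y
    _ = A ^ 2 * ∫⁻ y, g y ^ 2 ∂ν := by
        rw [lintegral_const_mul _ (hg.pow_const 2), sq, mul_assoc]

theorem lintegral_enorm_average_sq_add [IsFiniteMeasure μ] {g : X → 𝕜} (hg : MemLp g 2 μ) :
    ∫⁻ _, ‖⨍ y, g y ∂μ‖ₑ ^ 2 ∂μ + ∫⁻ x, ‖g x - ⨍ y, g y ∂μ‖ₑ ^ 2 ∂μ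
      = ∫⁻ x, ‖g x‖ₑ ^ 2 ∂μ := by
  set c := ⨍ y, g y ∂μ with hc
  have hcL : MemLp (fun _ : X => c) 2 μ := memLp_const c
  have hsub : MemLp (fun x => g x - c) 2 μ := hg.sub hcL
  have integral_eq : ∫ y, g y ∂μ = (μ.real Set.univ : 𝕜) * c := by
    rw [← measure_smul_average μ g, hc, RCLike.real_smul_eq_coe_mul]
  have expand (x : X) :
      ‖g x - c‖ ^ 2 = ‖g x‖ ^ 2 + ‖c‖ ^ 2 - 2 * RCLike.re (g x * (starRingEnd 𝕜) c) := by
    simpa only [RCLike.normSq_eq_def'] using RCLike.normSq_sub (g x) c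
  have int_sq : Integrable (fun x => ‖g x‖ ^ 2) μ :=
    (memLp_two_iff_integrable_sq_norm hg.aestronglyMeasurable).1 hg
  have int_mul : Integrable (fun x => g x * (starRingEnd 𝕜) c) μ :=
    (hg.integrable one_le_two).mul_const _
  have int_sq_add : Integrable (fun x => ‖g x‖ ^ 2 + ‖c‖ ^ 2) μ := int_sq.add (integrable_const _)
  rw [lintegral_enorm_sq_eq_ofReal hcL, lintegral_enorm_sq_eq_ofReal hg,
    lintegral_enorm_sq_eq_ofReal hsub, ← ENNReal.ofReal_add (by positivity) (by positivity)]
  simp_rw [expand]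
  rw [integral_sub int_sq_add (int_mul.re.const_mul 2), integral_add int_sq (integrable_const _),
    integral_const_mul, integral_re int_mul, integral_mul_const, integral_eq, mul_assoc,
    RCLike.mul_conj]
  simp only [integral_const, smul_eq_mul]
  norm_cast
  ring_nf

theorem real_bellman_inequality {G V I a b : ℝ} (hV : 0 < V) (ha : 0 ≤ a) (hb : 0 ≤ b)
    (hG : G ^ 2 ≤ (V + a) * I) (hab : a + b ≤ V) :
    b * (G / V) ^ 2 + 4 * ((G / V) ^ 2 * (1 + (a + b) / V)⁻¹ * V) ≤ 4 * I := by
  have denominators : b / V ^ 2 + 4 / (V + (a + b)) ≤ 4 / (V + a) := by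
    rw [div_add_div _ _ (by positivity) (by positivity), div_le_div_iff₀ (by positivity)
      (by positivity)]
    have product_le : (V + (a + b)) * (V + a) ≤ 4 * V ^ 2 := by nlinarith
    nlinarith [mul_le_mul_of_nonneg_left product_le hb]
  calc b * (G / V) ^ 2 + 4 * ((G / V) ^ 2 * (1 + (a + b) / V)⁻¹ * V)
      = G ^ 2 * (b / V ^ 2 + 4 / (V + (a + b))) := by field_simp
    _ ≤ G ^ 2 * (4 / (V + a)) := by gcongr
    _ = 4 * (G ^ 2 / (V + a)) := by ring
    _ ≤ 4 * I := by
        gcongr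
        rw [div_le_iff₀ (by positivity)]
        linarith

theorem ennreal_bellman_inequality {G V I a b : ℝ≥0∞} (h0 : V ≠ 0) (htop : V ≠ ∞)
    (hG : G ^ 2 ≤ (V + a) * I) (hab : a + b ≤ V) :
    (G / V) ^ 2 * b + 4 * ((G / V) ^ 2 * (1 + (a + b) / V)⁻¹ * V) ≤ 4 * I := by
  by_cases hI : I = ∞
  · simp [hI]
  have ha : a ≠ ∞ := ne_top_of_le_ne_top htop (le_self_add.trans hab)
  have hb : b ≠ ∞ := ne_top_of_le_ne_top htop (le_add_self.trans hab)
  have hGtop : G ≠ ∞ := fun h => by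
    simp [h, ENNReal.mul_eq_top, ha, htop, hI] at hG
  lift G to ℝ≥0 using hGtop
  lift V to ℝ≥0 using htop
  lift I to ℝ≥0 using hI
  lift a to ℝ≥0 using ha
  lift b to ℝ≥0 using hb
  have hV : V ≠ 0 := by simpa using h0
  rw [← ENNReal.coe_div hV, ← ENNReal.coe_add, ← ENNReal.coe_div hV, ← ENNReal.coe_one,
    ← ENNReal.coe_add, ← ENNReal.coe_inv (by positivity)]
  norm_cast at hG hab ⊢
  rw [mul_comm _ b, ← NNReal.coe_le_coe]
  exact_mod_cast real_bellman_inequality (NNReal.coe_pos.2 (pos_iff_ne_zero.2 hV)) a.2 b.2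
    (by exact_mod_cast hG) (by exact_mod_cast hab)

/-- The Bellman function `(g, M) ↦ 4 g² / (1 + M)` of the Carleson embedding theorem is
subharmonic: averaging it loses at least the contribution of the weight `w`. -/
theorem sq_laverage_mul_lintegral_add_le [IsFiniteMeasure μ] (hμ : μ ≠ 0) {g w M : X → ℝ≥0∞}
    (hg : AEMeasurable g μ) (hM : Measurable M) (hM1 : ∀ x, M x ≤ 1)
    (hMw : ⨍⁻ x, M x + w x ∂μ ≤ 1) :
    (⨍⁻ x, g x ∂μ) ^ 2 * ∫⁻ x, w x ∂μ +
        4 * ((⨍⁻ x, g x ∂μ) ^ 2 * (1 + ⨍⁻ x, M x + w x ∂μ)⁻¹ * μ Set.univ) ≤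
      4 * ∫⁻ x, g x ^ 2 * (1 + M x)⁻¹ ∂μ := by
  have univ_ne_zero : μ Set.univ ≠ 0 := Measure.measure_univ_ne_zero.2 hμ
  have cauchy_schwarz := sq_lintegral_le_lintegral_mul_lintegral_sq_mul_inv (μ := μ)
    (w := fun x => 1 + M x) (f := g) (by fun_prop) hg (by simp)
    fun x => ENNReal.add_ne_top.2
      ⟨ENNReal.one_ne_top, ne_top_of_le_ne_top ENNReal.one_ne_top (hM1 x)⟩
  rw [lintegral_add_left measurable_const, lintegral_const, one_mul] at cauchy_schwarz
  rw [laverage_eq, lintegral_add_left hM] at hMw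
  rw [laverage_eq, laverage_eq, lintegral_add_left hM]
  exact ennreal_bellman_inequality univ_ne_zero (measure_ne_top _ _) cauchy_schwarz
    (by simpa using (ENNReal.div_le_iff univ_ne_zero (measure_ne_top _ _)).1 hMw)

end LIntegral

section FiberAverage

variable {X ι 𝕜 : Type*} [MeasurableSpace X] [RCLike 𝕜] {μ : Measure X} {q : X → ι}

/-- The average of `f` over the fibre of `q` through a point. -/
noncomputable def fiberAverage (μ : Measure X) (q : X → ι) (f : X → 𝕜) (x : X) : 𝕜 :=
  ⨍ y in q ⁻¹' {q x}, f y ∂μ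

/-- The `[0, ∞]`-valued average of `f` over the fibre of `q` through a point. -/
noncomputable def fiberLAverage (μ : Measure X) (q : X → ι) (f : X → ℝ≥0∞) (x : X) : ℝ≥0∞ :=
  ⨍⁻ y in q ⁻¹' {q x}, f y ∂μ

theorem fiberAverage_of_mem {f : X → 𝕜} {x : X} {i : ι} (hx : x ∈ q ⁻¹' {i}) :
    fiberAverage μ q f x = ⨍ y in q ⁻¹' {i}, f y ∂μ := by
  rw [fiberAverage, show q x = i from hx]

theorem fiberLAverage_of_mem {f : X → ℝ≥0∞} {x : X} {i : ι} (hx : x ∈ q ⁻¹' {i}) :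
    fiberLAverage μ q f x = ⨍⁻ y in q ⁻¹' {i}, f y ∂μ := by
  rw [fiberLAverage, show q x = i from hx]

theorem fiberAverage_congr {f : X → 𝕜} {x y : X} (h : q x = q y) :
    fiberAverage μ q f x = fiberAverage μ q f y :=
  fiberAverage_of_mem h

theorem enorm_fiberAverage_le {g : X → 𝕜} {F : X → ℝ≥0∞} (h : ∀ x, ‖g x‖ₑ ≤ F x) (x : X) :
    ‖fiberAverage μ q g x‖ₑ ≤ fiberLAverage μ q F x :=
  (enorm_integral_le_lintegral_enorm _).trans (lintegral_mono h)

variable [MeasurableSpace ι] [MeasurableSingletonClass ι]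

theorem setIntegral_sub_fiberAverage_eq_zero (hq : Measurable q)
    (hfin : ∀ i, μ (q ⁻¹' {i}) ≠ ∞) (g : X → 𝕜) (i : ι) :
    ∫ x in q ⁻¹' {i}, (g x - fiberAverage μ q g x) ∂μ = 0 := by
  have := isFiniteMeasure_restrict.2 (hfin i)
  rw [setIntegral_congr_fun (hq (measurableSet_singleton i))
    fun x hx => by rw [fiberAverage_of_mem hx], integral_sub_average]

theorem setLIntegral_fiberLAverage (hq : Measurable q) (hfin : ∀ i, μ (q ⁻¹' {i}) ≠ ∞)
    (g : X → ℝ≥0∞) (i : ι) :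
    ∫⁻ x in q ⁻¹' {i}, fiberLAverage μ q g x ∂μ = ∫⁻ x in q ⁻¹' {i}, g x ∂μ := by
  have := isFiniteMeasure_restrict.2 (hfin i)
  rw [setLIntegral_congr_fun (hq (measurableSet_singleton i))
    fun x hx => fiberLAverage_of_mem hx, lintegral_laverage]

variable [Countable ι]

theorem measurable_fiberAverage (hq : Measurable q) (f : X → 𝕜) :
    Measurable (fiberAverage μ q f) :=
  (measurable_of_countable fun i => ⨍ y in q ⁻¹' {i}, f y ∂μ).comp hq

theorem measurable_fiberLAverage (hq : Measurable q) (f : X → ℝ≥0∞) :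
    Measurable (fiberLAverage μ q f) :=
  (measurable_of_countable fun i => ⨍⁻ y in q ⁻¹' {i}, f y ∂μ).comp hq

theorem lintegral_eq_tsum_fiber (hq : Measurable q) (f : X → ℝ≥0∞) :
    ∫⁻ x, f x ∂μ = ∑' i, ∫⁻ x in q ⁻¹' {i}, f x ∂μ := by
  rw [← lintegral_iUnion (fun i => hq (measurableSet_singleton i))
      (fun i j hij => Disjoint.preimage q (Set.disjoint_singleton.2 hij)),
    ← Set.preimage_iUnion, Set.iUnion_of_singleton, Set.preimage_univ, Measure.restrict_univ]

theorem lintegral_fiberAverage_sq_add (hq : Measurable q) (hfin : ∀ i, μ (q ⁻¹' {i}) ≠ ∞)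
    {g : X → 𝕜} (hg : MemLp g 2 μ) :
    ∫⁻ x, ‖fiberAverage μ q g x‖ₑ ^ 2 ∂μ + ∫⁻ x, ‖g x - fiberAverage μ q g x‖ₑ ^ 2 ∂μ
      = ∫⁻ x, ‖g x‖ₑ ^ 2 ∂μ := by
  simp only [lintegral_eq_tsum_fiber (μ := μ) hq, ← ENNReal.tsum_add]
  congr 1 with i
  have := isFiniteMeasure_restrict.2 (hfin i)
  rw [← lintegral_enorm_average_sq_add (hg.restrict (q ⁻¹' {i}))]
  congr 1 <;> exact setLIntegral_congr_fun (hq (measurableSet_singleton i))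
    fun x hx => by simp only [fiberAverage_of_mem hx]

theorem memLp_fiberAverage (hq : Measurable q) (hfin : ∀ i, μ (q ⁻¹' {i}) ≠ ∞)
    {g : X → 𝕜} (hg : MemLp g 2 μ) : MemLp (fiberAverage μ q g) 2 μ := by
  rw [memLp_two_iff_lintegral_lt_top (measurable_fiberAverage hq g).aestronglyMeasurable]
  refine lt_of_le_of_lt ?_ (lintegral_enorm_sq_lt_top hg)
  rw [← lintegral_fiberAverage_sq_add hq hfin hg]
  exact le_self_add

theorem integral_comp_mul_eq_zero (hq : Measurable q) {g : X → 𝕜} {φ : ι → 𝕜}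
    (hg : ∀ i, ∫ x in q ⁻¹' {i}, g x ∂μ = 0) (hi : Integrable (fun x => φ (q x) * g x) μ) :
    ∫ x, φ (q x) * g x ∂μ = 0 := by
  have cover : ⋃ i, q ⁻¹' {i} = Set.univ := by
    rw [← Set.preimage_iUnion, Set.iUnion_of_singleton, Set.preimage_univ]
  rw [← setIntegral_univ, ← cover, integral_iUnion (fun i => hq (measurableSet_singleton i))
    (fun i j hij => Disjoint.preimage q (Set.disjoint_singleton.2 hij)) hi.integrableOn]
  refine (tsum_congr fun i => ?_).trans tsum_zero
  rw [setIntegral_congr_fun (g := fun x => φ i * g x) (hq (measurableSet_singleton i))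
    fun x hx => by rw [show q x = i from hx], integral_const_mul, hg, mul_zero]

theorem fiberLAverage_comp_fiberLAverage {κ : Type*} (hq : Measurable q)
    (hfin : ∀ i, μ (q ⁻¹' {i}) ≠ ∞) (r : ι → κ) (g : X → ℝ≥0∞) :
    fiberLAverage μ (r ∘ q) (fiberLAverage μ q g) = fiberLAverage μ (r ∘ q) g := by
  ext x
  have fiber_eq : (r ∘ q) ⁻¹' {r (q x)} = ⋃ i ∈ r ⁻¹' {r (q x)}, q ⁻¹' {i} := by ext; simp
  have decompose (f : X → ℝ≥0∞) : ∫⁻ y in (r ∘ q) ⁻¹' {r (q x)}, f y ∂μ =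
      ∑' i : r ⁻¹' {r (q x)}, ∫⁻ y in q ⁻¹' {i.1}, f y ∂μ := by
    rw [fiber_eq, lintegral_biUnion (Set.to_countable _)
      (fun i _ => hq (measurableSet_singleton i))
      (fun i _ j _ hij => Disjoint.preimage q (Set.disjoint_singleton.2 hij))]
  rw [fiberLAverage, fiberLAverage, Function.comp_apply, setLAverage_eq, setLAverage_eq, decompose,
    decompose]
  simp only [setLIntegral_fiberLAverage hq hfin]

theorem lintegral_mul_sq_fiberLAverage_add_le (hq : Measurable q) (hfin : ∀ i, μ (q ⁻¹' {i}) ≠ ∞)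
    {g w M : X → ℝ≥0∞} (hg : AEMeasurable g μ) (hw : Measurable w) (hM : Measurable M)
    (hM1 : ∀ x, M x ≤ 1) (hMw : ∀ x, fiberLAverage μ q (fun y => M y + w y) x ≤ 1) :
    ∫⁻ x, fiberLAverage μ q g x ^ 2 * w x ∂μ + 4 * ∫⁻ x, fiberLAverage μ q g x ^ 2 *
        (1 + fiberLAverage μ q (fun y => M y + w y) x)⁻¹ ∂μ ≤
      4 * ∫⁻ x, g x ^ 2 * (1 + M x)⁻¹ ∂μ := by
  simp only [lintegral_eq_tsum_fiber (μ := μ) hq, ← ENNReal.tsum_mul_left, ← ENNReal.tsum_add]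
  refine ENNReal.tsum_le_tsum fun i => ?_
  by_cases h0 : μ.restrict (q ⁻¹' {i}) = 0
  · simp [h0]
  have := isFiniteMeasure_restrict.2 (hfin i)
  have hS := hq (measurableSet_singleton i)
  obtain ⟨x, hx⟩ : (q ⁻¹' {i}).Nonempty :=
    nonempty_of_measure_ne_zero fun h => h0 (Measure.restrict_eq_zero.2 h)
  have mean_le := hMw x
  rw [fiberLAverage_of_mem hx] at mean_le
  have weight_eq : ∫⁻ y in q ⁻¹' {i}, fiberLAverage μ q g y ^ 2 * w y ∂μ =
      (⨍⁻ z in q ⁻¹' {i}, g z ∂μ) ^ 2 * ∫⁻ y in q ⁻¹' {i}, w y ∂μ := by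
    rw [← lintegral_const_mul _ hw]
    exact setLIntegral_congr_fun hS fun y hy => by simp only [fiberLAverage_of_mem hy]
  have bellman_eq : ∫⁻ y in q ⁻¹' {i}, fiberLAverage μ q g y ^ 2 *
      (1 + fiberLAverage μ q (fun z => M z + w z) y)⁻¹ ∂μ =
      (⨍⁻ z in q ⁻¹' {i}, g z ∂μ) ^ 2 * (1 + ⨍⁻ z in q ⁻¹' {i}, M z + w z ∂μ)⁻¹ *
        μ.restrict (q ⁻¹' {i}) Set.univ := by
    rw [← lintegral_const]
    exact setLIntegral_congr_fun hS fun y hy => by simp only [fiberLAverage_of_mem hy]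
  rw [weight_eq, bellman_eq]
  exact sq_laverage_mul_lintegral_add_le h0 hg.restrict hM hM1 mean_le

end FiberAverage

section Majorant

variable {X : Type*} [PseudoMetricSpace X] [MeasurableSpace X] {μ : Measure X}

/-- The kernel of an averaging operator at scale `r`. Normalising by the ball of radius `2 * r`
rather than `r` bounds both marginals by `1`. -/
noncomputable def averagingKernel (μ : Measure X) (r : ℝ) (x y : X) : ℝ≥0∞ :=
  if dist x y < r then (μ (Metric.ball x (2 * r)))⁻¹ else 0

/-- A geometrically weighted sum of the averaging kernels at scales `2 ^ m * R`. It dominates the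
square function kernels, and its `L²` bound does not depend on the measure. -/
noncomputable def majorant (μ : Measure X) (α R : ℝ) (x y : X) : ℝ≥0∞ :=
  ∑' m : ℕ, ENNReal.ofReal (2 ^ (-α)) ^ m * averagingKernel μ (2 ^ m * R) x y

/-- The sum of the geometric weights of `majorant`, which bounds its marginals. -/
noncomputable def majorantBound (α : ℝ) : ℝ≥0 := (1 - 2 ^ (-α))⁻¹

theorem tsum_ofReal_two_rpow_neg {α : ℝ} (hα : 0 < α) :
    ∑' m : ℕ, ENNReal.ofReal (2 ^ (-α)) ^ m = majorantBound α := by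
  have ratio_lt_one : (2 : ℝ≥0) ^ (-α) < 1 :=
    NNReal.rpow_lt_one_of_one_lt_of_neg one_lt_two (neg_neg_of_pos hα)
  have ofReal_eq : ENNReal.ofReal (2 ^ (-α)) = ((2 : ℝ≥0) ^ (-α) : ℝ≥0) := by
    rw [← ENNReal.ofReal_coe_nnreal, NNReal.coe_rpow, NNReal.coe_ofNat]
  rw [ENNReal.tsum_geometric, ofReal_eq, majorantBound,
    ENNReal.coe_inv (tsub_pos_of_lt ratio_lt_one).ne', ENNReal.coe_sub, ENNReal.coe_one]

theorem le_majorant (α R : ℝ) {x y : X} (m : ℕ) (h : dist x y < 2 ^ m * R) :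
    ENNReal.ofReal (2 ^ (-α)) ^ m * (μ (Metric.ball x (2 * (2 ^ m * R))))⁻¹ ≤
      majorant μ α R x y := by
  refine le_trans ?_ (ENNReal.le_tsum m)
  rw [averagingKernel, if_pos h]

variable [OpensMeasurableSpace X]

theorem lintegral_averagingKernel_right_le (r : ℝ) (x : X) :
    ∫⁻ y, averagingKernel μ r x y ∂μ ≤ 1 := by
  have indicator_eq : averagingKernel μ r x =
      (Metric.ball x r).indicator fun _ => (μ (Metric.ball x (2 * r)))⁻¹ := by
    ext y
    simp [averagingKernel, Set.indicator, dist_comm]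
  rw [indicator_eq, lintegral_indicator Metric.isOpen_ball.measurableSet, setLIntegral_const]
  rcases lt_or_ge 0 r with hr | hr
  · refine le_trans ?_ (ENNReal.inv_mul_le_one (μ (Metric.ball x (2 * r))))
    gcongr
    linarith
  · simp [Metric.ball_eq_empty.2 hr]

theorem lintegral_averagingKernel_left_le (r : ℝ) (y : X) :
    ∫⁻ x, averagingKernel μ r x y ∂μ ≤ 1 := by
  calc ∫⁻ x, averagingKernel μ r x y ∂μ
      ≤ ∫⁻ x, (Metric.ball y r).indicator (fun _ => (μ (Metric.ball y r))⁻¹) x ∂μ := by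
        refine lintegral_mono fun x => ?_
        simp only [averagingKernel, Set.indicator, Metric.mem_ball]
        split_ifs with h
        · refine ENNReal.inv_le_inv.2 (measure_mono (Metric.ball_subset_ball' ?_))
          rw [dist_comm] at h
          linarith
        · exact le_rfl
    _ ≤ 1 := by
        rw [lintegral_indicator Metric.isOpen_ball.measurableSet, setLIntegral_const]
        exact ENNReal.inv_mul_le_one _

variable [SecondCountableTopology X] [SFinite μ]

theorem measurable_measure_ball (r : ℝ) : Measurable fun x => μ (Metric.ball x r) :=
  measurable_measure_prodMk_left (s := {p : X × X | dist p.2 p.1 < r})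
    (measurableSet_lt (by fun_prop) measurable_const)

theorem measurable_averagingKernel (r : ℝ) :
    Measurable (Function.uncurry (averagingKernel μ r)) :=
  Measurable.ite (measurableSet_lt (by fun_prop) measurable_const)
    ((measurable_measure_ball (2 * r)).comp measurable_fst).inv measurable_const

theorem measurable_majorant (α R : ℝ) : Measurable (Function.uncurry (majorant μ α R)) :=
  Measurable.tsum fun m => (measurable_averagingKernel (2 ^ m * R)).const_mul _

theorem lintegral_majorant_right_le {α : ℝ} (hα : 0 < α) (R : ℝ) (x : X) :
    ∫⁻ y, majorant μ α R x y ∂μ ≤ majorantBound α := by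
  have hm (m : ℕ) : Measurable (averagingKernel μ (2 ^ m * R) x) :=
    (measurable_averagingKernel _).of_uncurry_left
  simp only [majorant]
  rw [lintegral_tsum fun m => ((hm m).const_mul _).aemeasurable, ← tsum_ofReal_two_rpow_neg hα]
  refine ENNReal.tsum_le_tsum fun m => ?_
  rw [lintegral_const_mul _ (hm m)]
  exact mul_le_of_le_one_right' (lintegral_averagingKernel_right_le _ x)

theorem lintegral_majorant_left_le {α : ℝ} (hα : 0 < α) (R : ℝ) (y : X) :
    ∫⁻ x, majorant μ α R x y ∂μ ≤ majorantBound α := by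
  have hm (m : ℕ) : Measurable fun x => averagingKernel μ (2 ^ m * R) x y :=
    (measurable_averagingKernel _).of_uncurry_right
  simp only [majorant]
  rw [lintegral_tsum fun m => ((hm m).const_mul _).aemeasurable, ← tsum_ofReal_two_rpow_neg hα]
  refine ENNReal.tsum_le_tsum fun m => ?_
  rw [lintegral_const_mul _ (hm m)]
  exact mul_le_of_le_one_right' (lintegral_averagingKernel_left_le _ y)

theorem lintegral_sq_lintegral_majorant_mul_le {α : ℝ} (hα : 0 < α) (R : ℝ) {g : X → ℝ≥0∞}
    (hg : Measurable g) :
    ∫⁻ x, (∫⁻ y, majorant μ α R x y * g y ∂μ) ^ 2 ∂μ ≤ majorantBound α ^ 2 * ∫⁻ y, g y ^ 2 ∂μ :=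
  lintegral_sq_lintegral_mul_le (measurable_majorant α R) (lintegral_majorant_right_le hα R)
    (lintegral_majorant_left_le hα R) hg

end Majorant

/-- Kernel estimates in terms of the majorants, without reference to a dominating function.
Unlike `IsSquareKernel` it asks for measurability in all `t`, so kernels have to be set to `0` for
`t ≤ 0` before it applies. -/
structure IsMajorized {n : ℕ} {𝕜 : Type*} [RCLike 𝕜] (μ : Measure (Space n)) (α : ℝ) (C : ℝ≥0)
    (s : ℝ → Space n → Space n → 𝕜) : Prop where
  measurable : Measurable fun p : ℝ × Space n × Space n => s p.1 p.2.1 p.2.2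
  bounded : ∀ t, 0 < t → ∀ x, ∃ B : ℝ, ∀ y, ‖s t x y‖ ≤ B
  size : ∀ t, 0 < t → ∀ x y, ‖s t x y‖ₑ ≤ C * majorant μ α t x y
  far : ∀ t, 0 < t → ∀ R, 0 < R → ∀ x y, R ≤ dist x y →
    ‖s t x y‖ₑ ≤ C * ENNReal.ofReal ((t / R) ^ α) * majorant μ α R x y
  smooth : ∀ t, 0 < t → ∀ x y z, dist y z < t / 2 →
    ‖s t x y - s t x z‖ₑ ≤ C * ENNReal.ofReal ((dist y z / t) ^ α) * majorant μ α t x y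

/-- The constant in the domination of the kernel estimates by the majorants. -/
noncomputable def dominationConst (α Cl : ℝ) : ℝ := 2 ^ α * Cl ^ 2 + Cl

namespace IsUpperDoubling

variable {n : ℕ} {μ : Measure (Space n)} {lam : Space n → ℝ → ℝ} {α Cl : ℝ}

theorem one_le (h : IsUpperDoubling μ lam Cl) : 1 ≤ Cl := by
  have lam_pos := h.pos 0 1 one_pos
  have lam_mono : lam 0 1 ≤ lam 0 (2 * 1) := h.mono 0 (by simp) (by simp) (by norm_num)
  exact (le_mul_iff_one_le_left lam_pos).1 (lam_mono.trans (h.doubling 0 1 one_pos))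

theorem dominationConst_nonneg (h : IsUpperDoubling μ lam Cl) : 0 ≤ dominationConst α Cl := by
  have := h.one_le
  rw [dominationConst]
  positivity

theorem ofReal_inv_le (h : IsUpperDoubling μ lam Cl) (x : Space n) {r : ℝ} (hr : 0 < r) :
    ENNReal.ofReal (lam x r)⁻¹ ≤ (μ (Metric.ball x r))⁻¹ := by
  rw [ENNReal.ofReal_inv_of_pos (h.pos x r hr)]
  exact ENNReal.inv_le_inv.2 (h.measure_ball_le x r hr)

theorem inv_le (h : IsUpperDoubling μ lam Cl) (x : Space n) {r : ℝ} (hr : 0 < r) :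
    (lam x r)⁻¹ ≤ Cl * (lam x (2 * r))⁻¹ := by
  rw [← div_eq_mul_inv, inv_eq_one_div, div_le_div_iff₀ (h.pos x r hr)
    (h.pos x (2 * r) (by positivity)), one_mul]
  exact h.doubling x r hr

theorem inv_le_sq_mul_inv (h : IsUpperDoubling μ lam Cl) (x : Space n) {r d : ℝ} (hr : 0 < r)
    (hd : 0 < d) (hrd : r ≤ 4 * d) : (lam x d)⁻¹ ≤ Cl ^ 2 * (lam x r)⁻¹ := by
  have hCl := h.one_le
  calc (lam x d)⁻¹ ≤ Cl * (Cl * (lam x (2 * (2 * d)))⁻¹) := by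
        refine (h.inv_le x hd).trans ?_
        gcongr
        exact h.inv_le x (by positivity)
    _ ≤ Cl * (Cl * (lam x r)⁻¹) := by
        gcongr
        · exact h.pos x r hr
        · exact h.mono x hr (by simpa using hd) (by linarith)
    _ = Cl ^ 2 * (lam x r)⁻¹ := by ring

theorem rpow_mul_le_kernelDenom (h : IsUpperDoubling μ lam Cl) (hα : 0 < α) (t : ℝ)
    (x y : Space n) : t ^ α * lam x t ≤ kernelDenom lam α t x y := by
  rw [kernelDenom, le_add_iff_nonneg_right]
  rcases (norm_nonneg (x - y)).eq_or_lt with hxy | hxy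
  · rw [← hxy, Real.zero_rpow hα.ne', zero_mul]
  · exact mul_nonneg (by positivity) (h.pos x _ hxy).le

theorem dist_rpow_mul_le_kernelDenom (h : IsUpperDoubling μ lam Cl) {t : ℝ} (ht : 0 < t)
    (x y : Space n) : dist x y ^ α * lam x (dist x y) ≤ kernelDenom lam α t x y := by
  rw [kernelDenom, dist_eq_norm, le_add_iff_nonneg_left]
  exact mul_nonneg (by positivity) (h.pos x t ht).le

theorem kernelDenom_pos (h : IsUpperDoubling μ lam Cl) (hα : 0 < α) {t : ℝ} (ht : 0 < t)
    (x y : Space n) : 0 < kernelDenom lam α t x y :=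
  (mul_pos (Real.rpow_pos_of_pos ht α) (h.pos x t ht)).trans_le (h.rpow_mul_le_kernelDenom hα t x y)

theorem div_kernelDenom_le (h : IsUpperDoubling μ lam Cl) (hα : 0 < α) {t : ℝ} (ht : 0 < t)
    (x y : Space n) : t ^ α / kernelDenom lam α t x y ≤ (lam x t)⁻¹ := by
  have lam_pos := h.pos x t ht
  rw [div_le_iff₀ (h.kernelDenom_pos hα ht x y), inv_mul_eq_div, le_div_iff₀ lam_pos]
  exact h.rpow_mul_le_kernelDenom hα t x y

theorem div_kernelDenom_le_of_pow_mul_le (h : IsUpperDoubling μ lam Cl) (hα : 0 < α) {t R : ℝ}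
    (ht : 0 < t) (hR : 0 < R) {x y : Space n} {m : ℕ} (hm : 2 ^ m * R ≤ dist x y) :
    t ^ α / kernelDenom lam α t x y ≤
      2 ^ α * Cl ^ 2 * (t / R) ^ α *
        ((2 ^ (-α)) ^ (m + 1) * (lam x (2 * (2 ^ (m + 1) * R)))⁻¹) := by
  have dist_pos : 0 < dist x y := lt_of_lt_of_le (by positivity) hm
  have lam_pos := h.pos x _ dist_pos
  have : (0 : ℝ) < 2 ^ α := by positivity
  calc t ^ α / kernelDenom lam α t x y ≤ t ^ α / ((2 ^ m * R) ^ α * lam x (dist x y)) := by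
        gcongr
        refine le_trans ?_ (h.dist_rpow_mul_le_kernelDenom ht x y)
        gcongr
    _ = t ^ α / (2 ^ m * R) ^ α * (lam x (dist x y))⁻¹ := by field_simp
    _ ≤ t ^ α / (2 ^ m * R) ^ α * (Cl ^ 2 * (lam x (2 * (2 ^ (m + 1) * R)))⁻¹) := by
        gcongr
        refine h.inv_le_sq_mul_inv x (by positivity) dist_pos ?_
        rw [pow_succ]
        linarith
    _ = _ := by
        rw [Real.mul_rpow (by positivity) hR.le, Real.div_rpow ht.le hR.le,
          Real.rpow_neg zero_le_two, ← Real.rpow_pow_comm zero_le_two, inv_pow]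
        field_simp
        rw [pow_succ' (2 ^ α) m]
        ring

theorem ofReal_div_kernelDenom_le_of_le_dist (h : IsUpperDoubling μ lam Cl) (hα : 0 < α) {t R : ℝ}
    (ht : 0 < t) (hR : 0 < R) {x y : Space n} (hxy : R ≤ dist x y) :
    ENNReal.ofReal (t ^ α / kernelDenom lam α t x y) ≤
      ENNReal.ofReal (dominationConst α Cl) * ENNReal.ofReal ((t / R) ^ α) *
        majorant μ α R x y := by
  obtain ⟨m, pow_le, lt_pow⟩ :=
    exists_nat_pow_near (x := dist x y / R) ((one_le_div hR).2 hxy) one_lt_two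
  rw [le_div_iff₀ hR] at pow_le
  rw [div_lt_iff₀ hR] at lt_pow
  have hCl := h.one_le
  have hD := h.dominationConst_nonneg (α := α)
  have lam_pos := h.pos x (2 * (2 ^ (m + 1) * R)) (by positivity)
  have le_dominationConst : 2 ^ α * Cl ^ 2 ≤ dominationConst α Cl := by
    rw [dominationConst]
    linarith
  calc ENNReal.ofReal (t ^ α / kernelDenom lam α t x y)
      ≤ ENNReal.ofReal (dominationConst α Cl * (t / R) ^ α *
          ((2 ^ (-α)) ^ (m + 1) * (lam x (2 * (2 ^ (m + 1) * R)))⁻¹)) := by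
        refine ENNReal.ofReal_le_ofReal
          ((h.div_kernelDenom_le_of_pow_mul_le hα ht hR pow_le).trans ?_)
        gcongr
    _ = ENNReal.ofReal (dominationConst α Cl) * ENNReal.ofReal ((t / R) ^ α) *
          (ENNReal.ofReal (2 ^ (-α)) ^ (m + 1) *
            ENNReal.ofReal (lam x (2 * (2 ^ (m + 1) * R)))⁻¹) := by
        rw [ENNReal.ofReal_mul (by positivity), ENNReal.ofReal_mul hD,
          ENNReal.ofReal_mul (by positivity), ENNReal.ofReal_pow (by positivity)]
    _ ≤ _ := by
        gcongr
        refine le_trans ?_ (le_majorant α R (m + 1) lt_pow)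
        gcongr
        exact h.ofReal_inv_le x (by positivity)

theorem ofReal_div_kernelDenom_le (h : IsUpperDoubling μ lam Cl) (hα : 0 < α) {t : ℝ}
    (ht : 0 < t) (x y : Space n) :
    ENNReal.ofReal (t ^ α / kernelDenom lam α t x y) ≤
      ENNReal.ofReal (dominationConst α Cl) * majorant μ α t x y := by
  rcases le_or_gt t (dist x y) with hxy | hxy
  · simpa [div_self ht.ne'] using h.ofReal_div_kernelDenom_le_of_le_dist hα ht ht hxy
  have hCl := h.one_le
  have lam_pos := h.pos x (2 * t) (by positivity)
  have le_dominationConst : Cl ≤ dominationConst α Cl := by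
    rw [dominationConst, le_add_iff_nonneg_left]
    positivity
  calc ENNReal.ofReal (t ^ α / kernelDenom lam α t x y)
      ≤ ENNReal.ofReal (dominationConst α Cl * (lam x (2 * t))⁻¹) := by
        refine ENNReal.ofReal_le_ofReal ((h.div_kernelDenom_le hα ht x y).trans ?_)
        refine (h.inv_le x ht).trans ?_
        gcongr
    _ ≤ ENNReal.ofReal (dominationConst α Cl) * majorant μ α t x y := by
        rw [ENNReal.ofReal_mul h.dominationConst_nonneg]
        gcongr
        refine (h.ofReal_inv_le x (by positivity)).trans ?_
        simpa using le_majorant (μ := μ) α t (x := x) (y := y) 0 (by simpa using hxy)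

end IsUpperDoubling

namespace IsSquareKernel

variable {n : ℕ} {μ : Measure (Space n)} {𝕜 : Type*} [RCLike 𝕜] {lam : Space n → ℝ → ℝ}
  {α Cl K : ℝ} {s : ℝ → Space n → Space n → 𝕜}

theorem norm_le (hs : IsSquareKernel lam α K s) (h : IsUpperDoubling μ lam Cl) (hα : 0 < α)
    {t : ℝ} (ht : 0 < t) (x y : Space n) :
    ‖s t x y‖ ≤ |K| * (t ^ α / kernelDenom lam α t x y) := by
  have := h.kernelDenom_pos hα ht x y
  refine (hs.size t ht x y).trans ?_
  gcongr
  exact le_abs_self K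

theorem enorm_le (hs : IsSquareKernel lam α K s) (h : IsUpperDoubling μ lam Cl) (hα : 0 < α)
    {t : ℝ} (ht : 0 < t) (x y : Space n) :
    ‖s t x y‖ₑ ≤ ENNReal.ofReal |K| * ENNReal.ofReal (t ^ α / kernelDenom lam α t x y) := by
  rw [← ENNReal.ofReal_mul (abs_nonneg K), ← ofReal_norm]
  exact ENNReal.ofReal_le_ofReal (hs.norm_le h hα ht x y)

theorem enorm_sub_le (hs : IsSquareKernel lam α K s) (h : IsUpperDoubling μ lam Cl) (hα : 0 < α)
    {t : ℝ} (ht : 0 < t) {x y z : Space n} (hyz : dist y z < t / 2) :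
    ‖s t x y - s t x z‖ₑ ≤ ENNReal.ofReal |K| * ENNReal.ofReal ((dist y z / t) ^ α) *
      ENNReal.ofReal (t ^ α / kernelDenom lam α t x y) := by
  have := h.kernelDenom_pos hα ht x y
  have factor : dist y z ^ α / kernelDenom lam α t x y =
      (dist y z / t) ^ α * (t ^ α / kernelDenom lam α t x y) := by
    rw [Real.div_rpow dist_nonneg ht.le]
    field_simp
  rw [mul_assoc, ← ENNReal.ofReal_mul (by positivity), ← ENNReal.ofReal_mul (abs_nonneg K),
    ← ofReal_norm, ← factor]
  refine ENNReal.ofReal_le_ofReal ((hs.smooth t ht x y z (by rwa [← dist_eq_norm])).trans ?_)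
  rw [dist_eq_norm]
  gcongr
  exact le_abs_self K

theorem measurable_extend_zero (hs : IsSquareKernel lam α K s) :
    Measurable fun p : ℝ × Space n × Space n => if 0 < p.1 then s p.1 p.2.1 p.2.2 else 0 := by
  have measurable_restrict : Measurable fun p : {p : ℝ × Space n × Space n | 0 < p.1} =>
      s p.1.1 p.1.2.1 p.1.2.2 :=
    hs.measurable.comp (f := fun p : {p : ℝ × Space n × Space n | 0 < p.1} =>
        ((⟨p.1.1, p.2⟩, p.1.2) : Set.Ioi (0 : ℝ) × Space n × Space n))
      ((measurable_fst.comp measurable_subtype_coe).subtype_mk.prodMk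
        (measurable_snd.comp measurable_subtype_coe))
  classical
  simpa only [Set.mem_ofPred_eq, dite_eq_ite] using
    measurable_restrict.dite (measurable_const (a := (0 : 𝕜)))
      (measurableSet_lt measurable_const measurable_fst)

theorem isMajorized (hs : IsSquareKernel lam α K s) (h : IsUpperDoubling μ lam Cl) (hα : 0 < α) :
    IsMajorized μ α (|K| * dominationConst α Cl).toNNReal
      (fun t x y => if 0 < t then s t x y else 0) := by
  have const_eq : ((|K| * dominationConst α Cl).toNNReal : ℝ≥0∞) =
      ENNReal.ofReal |K| * ENNReal.ofReal (dominationConst α Cl) :=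
    ENNReal.ofReal_mul (abs_nonneg K)
  refine ⟨hs.measurable_extend_zero, fun t ht x => ⟨|K| * (lam x t)⁻¹, fun y => ?_⟩,
    fun t ht x y => ?_, fun t ht R hR x y hxy => ?_, fun t ht x y z hyz => ?_⟩ <;>
    simp only [ht, if_true]
  · refine (hs.norm_le h hα ht x y).trans ?_
    gcongr
    exact h.div_kernelDenom_le hα ht x y
  · refine (hs.enorm_le h hα ht x y).trans ?_
    rw [const_eq, mul_assoc]
    gcongr
    exact h.ofReal_div_kernelDenom_le hα ht x y
  · refine (hs.enorm_le h hα ht x y).trans ?_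
    rw [const_eq, mul_assoc, mul_assoc, ← mul_assoc (ENNReal.ofReal (dominationConst α Cl))]
    gcongr
    exact h.ofReal_div_kernelDenom_le_of_le_dist hα ht hR hxy
  · refine (hs.enorm_sub_le h hα ht hyz).trans ?_
    rw [const_eq, mul_right_comm _ (ENNReal.ofReal (dominationConst α Cl)),
      mul_assoc _ (ENNReal.ofReal (dominationConst α Cl))]
    gcongr
    exact h.ofReal_div_kernelDenom_le hα ht x y

end IsSquareKernel

section Operators

theorem integrable_mul_of_bounded {X 𝕜 : Type*} [MeasurableSpace X] [RCLike 𝕜] {μ : Measure X}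
    {φ g : X → 𝕜} {B : ℝ} (hφ : Integrable φ μ) (hB : ∀ x, ‖φ x‖ ≤ B) (hg : MemLp g 2 μ) :
    Integrable (fun x => φ x * g x) μ := by
  have memLp_φ : MemLp φ 2 μ := by
    rw [memLp_two_iff_integrable_sq_norm hφ.aestronglyMeasurable]
    refine (hφ.norm.const_mul B).mono' (hφ.aestronglyMeasurable.norm.pow 2)
      (Filter.Eventually.of_forall fun x => ?_)
    rw [Real.norm_of_nonneg (by positivity), sq]
    exact mul_le_mul_of_nonneg_right (hB x) (norm_nonneg _)
  exact memLp_φ.integrable_mul hg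

variable {n : ℕ} {μ : Measure (Space n)} {𝕜 : Type*} [RCLike 𝕜] {α : ℝ} {C : ℝ≥0}
  {s : ℝ → Space n → Space n → 𝕜}

namespace IsMajorized

theorem measurable_kernel (hs : IsMajorized μ α C s) (t : ℝ) (x : Space n) :
    Measurable (s t x) :=
  hs.measurable.comp (f := fun y => (t, x, y)) (by fun_prop)

theorem enorm_theta_le (hs : IsMajorized μ α C s) {t : ℝ} (ht : 0 < t) (g : Space n → 𝕜)
    (x : Space n) :
    ‖theta μ s t g x‖ₑ ≤ C * ∫⁻ y, majorant μ α t x y * ‖g y‖ₑ ∂μ := by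
  refine (enorm_integral_le_lintegral_enorm _).trans ?_
  rw [← lintegral_const_mul' _ _ ENNReal.coe_ne_top]
  refine lintegral_mono fun y => ?_
  rw [enorm_mul, ← mul_assoc]
  exact mul_le_mul' (hs.size t ht x y) le_rfl

theorem enorm_theta_le_of_vanishing (hs : IsMajorized μ α C s) {t R : ℝ} (ht : 0 < t) (hR : 0 < R)
    {g : Space n → 𝕜} {x : Space n} (hg : ∀ y, dist x y < R → g y = 0) :
    ‖theta μ s t g x‖ₑ ≤
      C * ENNReal.ofReal ((t / R) ^ α) * ∫⁻ y, majorant μ α R x y * ‖g y‖ₑ ∂μ := by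
  refine (enorm_integral_le_lintegral_enorm _).trans ?_
  rw [← lintegral_const_mul' _ _ (ENNReal.mul_ne_top ENNReal.coe_ne_top ENNReal.ofReal_ne_top)]
  refine lintegral_mono fun y => ?_
  rw [enorm_mul, ← mul_assoc]
  rcases lt_or_ge (dist x y) R with h | h
  · simp [hg y h]
  · exact mul_le_mul' (hs.far t ht R hR x y h) le_rfl

variable [SFinite μ]

theorem integrable (hs : IsMajorized μ α C s) (hα : 0 < α) {t : ℝ} (ht : 0 < t) (x : Space n) :
    Integrable (s t x) μ := by
  refine ⟨(hs.measurable_kernel t x).aestronglyMeasurable, ?_⟩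
  refine lt_of_le_of_lt (lintegral_mono fun y => hs.size t ht x y) ?_
  rw [lintegral_const_mul _ ((measurable_majorant α t).of_uncurry_left)]
  exact ENNReal.mul_lt_top ENNReal.coe_lt_top
    ((lintegral_majorant_right_le hα t x).trans_lt ENNReal.coe_lt_top)

theorem integrable_mul (hs : IsMajorized μ α C s) (hα : 0 < α) {t : ℝ} (ht : 0 < t) (x : Space n)
    {g : Space n → 𝕜} (hg : MemLp g 2 μ) : Integrable (fun y => s t x y * g y) μ := by
  obtain ⟨B, hB⟩ := hs.bounded t ht x
  exact integrable_mul_of_bounded (hs.integrable hα ht x) hB hg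

theorem measurable_theta_uncurry (hs : IsMajorized μ α C s) {f : Space n → 𝕜}
    (hf : Measurable f) : Measurable fun p : ℝ × Space n => theta μ s p.1 f p.2 := by
  have measurable_integrand :
      Measurable fun p : (ℝ × Space n) × Space n => s p.1.1 p.1.2 p.2 * f p.2 :=
    (hs.measurable.comp (f := fun p : (ℝ × Space n) × Space n => (p.1.1, p.1.2, p.2))
      (by fun_prop)).mul (hf.comp measurable_snd)
  exact (StronglyMeasurable.integral_prod_right' measurable_integrand.stronglyMeasurable).measurable

theorem measurable_theta (hs : IsMajorized μ α C s) {f : Space n → 𝕜} (hf : Measurable f)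
    (t : ℝ) : Measurable (theta μ s t f) :=
  (hs.measurable_theta_uncurry hf).comp measurable_prodMk_left

theorem integrable_kernel_comp (hs : IsMajorized μ α C s) (hα : 0 < α) {t d : ℝ} (ht : 0 < t)
    (hd : d < t / 2) (x : Space n) {p : Space n → Space n} (hp : Measurable p)
    (hpd : ∀ y, dist y (p y) ≤ d) : Integrable (fun y => s t x (p y)) μ := by
  have integrable_sub : Integrable (fun y => s t x y - s t x (p y)) μ := by
    refine ⟨((hs.measurable_kernel t x).sub
      ((hs.measurable_kernel t x).comp hp)).aestronglyMeasurable, ?_⟩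
    calc ∫⁻ y, ‖s t x y - s t x (p y)‖ₑ ∂μ
        ≤ ∫⁻ y, C * ENNReal.ofReal ((d / t) ^ α) * majorant μ α t x y ∂μ := by
          refine lintegral_mono fun y => (hs.smooth t ht x y _ ((hpd y).trans_lt hd)).trans ?_
          gcongr
          exact hpd y
      _ < ∞ := by
          rw [lintegral_const_mul _ (measurable_majorant α t).of_uncurry_left]
          exact ENNReal.mul_lt_top (ENNReal.mul_lt_top ENNReal.coe_lt_top ENNReal.ofReal_lt_top)
            ((lintegral_majorant_right_le hα t x).trans_lt ENNReal.coe_lt_top)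
  exact ((hs.integrable hα ht x).sub integrable_sub).congr
    (Filter.Eventually.of_forall fun y => sub_sub_cancel _ _)

/-- For `t / 2 ≤ d` the gain is at least `1`, and the size estimate alone suffices. -/
theorem enorm_theta_le_of_mean_zero (hs : IsMajorized μ α C s) (hα : 0 < α) {ι : Type*}
    [MeasurableSpace ι] [Countable ι] [MeasurableSingletonClass ι] {q : Space n → ι}
    (hq : Measurable q) {rep : ι → Space n} {t d : ℝ} (ht : 0 < t)
    (hrep : ∀ y, dist y (rep (q y)) ≤ d) {g : Space n → 𝕜} (hg : MemLp g 2 μ)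
    (hg0 : ∀ i, ∫ x in q ⁻¹' {i}, g x ∂μ = 0) (x : Space n) :
    ‖theta μ s t g x‖ₑ ≤
      C * ENNReal.ofReal ((2 * d / t) ^ α) * ∫⁻ y, majorant μ α t x y * ‖g y‖ₑ ∂μ := by
  have d_nonneg : 0 ≤ d := dist_nonneg.trans (hrep x)
  rcases le_or_gt (t / 2) d with hd | hd
  · refine (hs.enorm_theta_le ht g x).trans ?_
    gcongr
    refine le_mul_of_one_le_right' (ENNReal.one_le_ofReal.2 ?_)
    exact Real.one_le_rpow ((one_le_div ht).2 (by linarith)) hα.le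
  have measurable_rep : Measurable fun y => rep (q y) := (measurable_of_countable rep).comp hq
  obtain ⟨B, hB⟩ := hs.bounded t ht x
  have integrable_rep_mul : Integrable (fun y => s t x (rep (q y)) * g y) μ :=
    integrable_mul_of_bounded (hs.integrable_kernel_comp hα ht hd x measurable_rep hrep)
      (fun y => hB _) hg
  have integral_rep_mul : ∫ y, s t x (rep (q y)) * g y ∂μ = 0 :=
    integral_comp_mul_eq_zero (φ := fun i => s t x (rep i)) hq hg0 integrable_rep_mul
  have theta_eq : theta μ s t g x = ∫ y, (s t x y - s t x (rep (q y))) * g y ∂μ := by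
    simp_rw [sub_mul]
    rw [integral_sub (hs.integrable_mul hα ht x hg) integrable_rep_mul, integral_rep_mul,
      sub_zero, theta]
  rw [theta_eq]
  refine (enorm_integral_le_lintegral_enorm _).trans ?_
  rw [← lintegral_const_mul' _ _ (ENNReal.mul_ne_top ENNReal.coe_ne_top ENNReal.ofReal_ne_top)]
  refine lintegral_mono fun y => ?_
  rw [enorm_mul, ← mul_assoc]
  gcongr
  refine (hs.smooth t ht x y _ ((hrep y).trans_lt hd)).trans ?_
  gcongr
  linarith [hrep y]

theorem lintegral_theta_sq_le_of_mean_zero (hs : IsMajorized μ α C s) (hα : 0 < α) {ι : Type*}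
    [MeasurableSpace ι] [Countable ι] [MeasurableSingletonClass ι] {q : Space n → ι}
    (hq : Measurable q) {rep : ι → Space n} {t d : ℝ} (ht : 0 < t)
    (hrep : ∀ y, dist y (rep (q y)) ≤ d) {g : Space n → 𝕜} (hgm : Measurable g)
    (hg : MemLp g 2 μ) (hg0 : ∀ i, ∫ x in q ⁻¹' {i}, g x ∂μ = 0) :
    ∫⁻ x, ‖theta μ s t g x‖ₑ ^ 2 ∂μ ≤
      (C * ENNReal.ofReal ((2 * d / t) ^ α) * majorantBound α) ^ 2 * ∫⁻ y, ‖g y‖ₑ ^ 2 ∂μ := by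
  calc ∫⁻ x, ‖theta μ s t g x‖ₑ ^ 2 ∂μ
      ≤ ∫⁻ x, (C * ENNReal.ofReal ((2 * d / t) ^ α)) ^ 2 *
          (∫⁻ y, majorant μ α t x y * ‖g y‖ₑ ∂μ) ^ 2 ∂μ := by
        refine lintegral_mono fun x => ?_
        rw [← mul_pow]
        gcongr
        exact hs.enorm_theta_le_of_mean_zero hα hq ht hrep hg hg0 x
    _ ≤ (C * ENNReal.ofReal ((2 * d / t) ^ α)) ^ 2 *
          (majorantBound α ^ 2 * ∫⁻ y, ‖g y‖ₑ ^ 2 ∂μ) := by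
        rw [lintegral_const_mul' _ _ (by finiteness)]
        gcongr
        exact lintegral_sq_lintegral_majorant_mul_le hα t hgm.enorm
    _ = _ := by ring

theorem enorm_theta_sub_mul_le (hs : IsMajorized μ α C s) (hα : 0 < α) {t R : ℝ} (ht : 0 < t)
    (hR : 0 < R) {g : Space n → 𝕜} (hg : MemLp g 2 μ) {x : Space n}
    (hx : ∀ y, dist x y < R → g y = g x) :
    ‖theta μ s t g x - g x * theta μ s t 1 x‖ₑ ≤ C * ENNReal.ofReal ((t / R) ^ α) *
      (∫⁻ y, majorant μ α R x y * ‖g y‖ₑ ∂μ + majorantBound α * ‖g x‖ₑ) := by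
  have sub_eq : theta μ s t g x - g x * theta μ s t 1 x = theta μ s t (fun y => g y - g x) x := by
    simp only [theta, Pi.one_apply, mul_one, mul_sub]
    rw [integral_sub (hs.integrable_mul hα ht x hg) ((hs.integrable hα ht x).mul_const _),
      integral_mul_const, mul_comm (g x)]
  have measurable_majorant_x : Measurable (majorant μ α R x) :=
    (measurable_majorant α R).of_uncurry_left
  rw [sub_eq]
  refine (hs.enorm_theta_le_of_vanishing ht hR fun y hy => by rw [hx y hy, sub_self]).trans ?_
  gcongr
  calc ∫⁻ y, majorant μ α R x y * ‖g y - g x‖ₑ ∂μ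
      ≤ ∫⁻ y, (majorant μ α R x y * ‖g y‖ₑ + majorant μ α R x y * ‖g x‖ₑ) ∂μ := by
        refine lintegral_mono fun y => ?_
        rw [← mul_add]
        exact mul_le_mul' le_rfl enorm_sub_le
    _ = ∫⁻ y, majorant μ α R x y * ‖g y‖ₑ ∂μ + (∫⁻ y, majorant μ α R x y ∂μ) * ‖g x‖ₑ := by
        rw [lintegral_add_right _ (measurable_majorant_x.mul_const _),
          lintegral_mul_const _ measurable_majorant_x]
    _ ≤ _ := by
        gcongr
        exact lintegral_majorant_right_le hα R x

theorem setLIntegral_theta_sub_mul_sq_le (hs : IsMajorized μ α C s) (hα : 0 < α) {t R : ℝ}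
    (ht : 0 < t) (hR : 0 < R) {g : Space n → 𝕜} (hgm : Measurable g) (hg : MemLp g 2 μ)
    {G : Set (Space n)} (hG : MeasurableSet G) (hx : ∀ x ∈ G, ∀ y, dist x y < R → g y = g x) :
    ∫⁻ x in G, ‖theta μ s t g x - g x * theta μ s t 1 x‖ₑ ^ 2 ∂μ ≤
      4 * (C * ENNReal.ofReal ((t / R) ^ α) * majorantBound α) ^ 2 * ∫⁻ y, ‖g y‖ₑ ^ 2 ∂μ := by
  calc ∫⁻ x in G, ‖theta μ s t g x - g x * theta μ s t 1 x‖ₑ ^ 2 ∂μ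
      ≤ ∫⁻ x in G, 2 * (C * ENNReal.ofReal ((t / R) ^ α)) ^ 2 *
        ((∫⁻ y, majorant μ α R x y * ‖g y‖ₑ ∂μ) ^ 2 + majorantBound α ^ 2 * ‖g x‖ₑ ^ 2) ∂μ := by
        refine setLIntegral_mono' hG fun x hxG => ?_
        refine (pow_le_pow_left' (hs.enorm_theta_sub_mul_le hα ht hR hg (hx x hxG)) 2).trans ?_
        rw [mul_pow, mul_comm 2, mul_assoc, ← mul_pow (majorantBound α : ℝ≥0∞)]
        exact mul_le_mul' le_rfl (ennreal_add_sq_le _ _)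
    _ ≤ ∫⁻ x, 2 * (C * ENNReal.ofReal ((t / R) ^ α)) ^ 2 *
        ((∫⁻ y, majorant μ α R x y * ‖g y‖ₑ ∂μ) ^ 2 + majorantBound α ^ 2 * ‖g x‖ₑ ^ 2) ∂μ :=
        setLIntegral_le_lintegral _ _
    _ = 2 * (C * ENNReal.ofReal ((t / R) ^ α)) ^ 2 *
        (∫⁻ x, (∫⁻ y, majorant μ α R x y * ‖g y‖ₑ ∂μ) ^ 2 ∂μ +
          majorantBound α ^ 2 * ∫⁻ x, ‖g x‖ₑ ^ 2 ∂μ) := by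
        rw [lintegral_const_mul' _ _ (by finiteness), lintegral_add_right _
          ((hgm.enorm.pow_const 2).const_mul _), lintegral_const_mul _ (hgm.enorm.pow_const 2)]
    _ ≤ 2 * (C * ENNReal.ofReal ((t / R) ^ α)) ^ 2 *
        (majorantBound α ^ 2 * ∫⁻ x, ‖g x‖ₑ ^ 2 ∂μ +
          majorantBound α ^ 2 * ∫⁻ x, ‖g x‖ₑ ^ 2 ∂μ) := by
        gcongr
        exact lintegral_sq_lintegral_majorant_mul_le hα R hgm.enorm
    _ = _ := by ring

theorem enorm_theta_one_sub_le (hs : IsMajorized μ α C s) (hα : 0 < α) {t R : ℝ} (ht : 0 < t)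
    (hR : 0 < R) {B : Set (Space n)} (hB : MeasurableSet B) {x : Space n}
    (hx : Metric.ball x R ⊆ B) :
    ‖theta μ s t 1 x - theta μ s t (B.indicator 1) x‖ₑ ≤
      C * ENNReal.ofReal ((t / R) ^ α) * majorantBound α := by
  have integrable_kernel := hs.integrable hα ht x
  have sub_eq : theta μ s t 1 x - theta μ s t (B.indicator 1) x =
      theta μ s t (Bᶜ.indicator 1) x := by
    rw [sub_eq_iff_eq_add]
    simp only [theta, Pi.one_apply, mul_one]
    have mul_indicator (A : Set (Space n)) : (fun y => s t x y * A.indicator 1 y) =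
        A.indicator (s t x) := by
      ext y
      by_cases hy : y ∈ A <;> simp [hy]
    rw [mul_indicator, mul_indicator, integral_indicator hB, integral_indicator hB.compl,
      add_comm, integral_add_compl hB integrable_kernel]
  rw [sub_eq]
  refine (hs.enorm_theta_le_of_vanishing ht hR fun y hy => ?_).trans ?_
  · simpa using hx (by rwa [Metric.mem_ball, dist_comm])
  · gcongr
    refine (lintegral_mono fun y => mul_le_of_le_one_right' ?_).trans
      (lintegral_majorant_right_le hα R x)
    by_cases hy : y ∈ B <;> simp [hy]

end IsMajorized

end Operators

section Grids

variable {n : ℕ}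

/-- The index of the half-open cube containing `x` in the grid of mesh `ℓ` shifted by `u`. -/
noncomputable def gridIndex (u : Space n) (ℓ : ℝ) (x : Space n) : Fin n → ℤ :=
  fun c => ⌊(x c - u c) / ℓ⌋

/-- The centre of the cube with a given index. -/
noncomputable def gridCenter (u : Space n) (ℓ : ℝ) (i : Fin n → ℤ) : Space n :=
  fun c => u c + (i c + 1 / 2) * ℓ

/-- The points at distance at least `ε * ℓ` from the boundary of the grid cube containing them. -/
def IsInner (u : Space n) (ℓ ε : ℝ) (x : Space n) : Prop :=
  dist x (gridCenter u ℓ (gridIndex u ℓ x)) ≤ (1 / 2 - ε) * ℓ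

theorem measurable_gridIndex (u : Space n) (ℓ : ℝ) : Measurable (gridIndex u ℓ) :=
  measurable_pi_lambda _ fun c => Int.measurable_floor.comp (by fun_prop)

theorem gridIndex_two_mul (u : Space n) (ℓ : ℝ) (x : Space n) :
    gridIndex u (2 * ℓ) x = fun c => gridIndex u ℓ x c / 2 := by
  ext c
  rw [gridIndex, gridIndex, mul_comm, ← div_div]
  exact_mod_cast Int.floor_div_natCast ((x c - u c) / ℓ) 2

theorem abs_sub_gridCenter (u : Space n) {ℓ : ℝ} (hℓ : 0 < ℓ) (x : Space n) (c : Fin n) :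
    |x c - gridCenter u ℓ (gridIndex u ℓ x) c| = |Int.fract ((x c - u c) / ℓ) - 1 / 2| * ℓ := by
  rw [← abs_of_pos hℓ, ← abs_mul, abs_of_pos hℓ, gridCenter, gridIndex, Int.fract]
  congr 1
  field_simp
  ring

theorem dist_gridCenter_le (u : Space n) {ℓ : ℝ} (hℓ : 0 < ℓ) (x : Space n) :
    dist x (gridCenter u ℓ (gridIndex u ℓ x)) ≤ ℓ / 2 := by
  refine (dist_pi_le_iff (by positivity)).2 fun c => ?_
  have fract_nonneg := Int.fract_nonneg ((x c - u c) / ℓ)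
  have fract_lt_one := Int.fract_lt_one ((x c - u c) / ℓ)
  have abs_le_half : |Int.fract ((x c - u c) / ℓ) - 1 / 2| ≤ 1 / 2 :=
    abs_le.2 ⟨by linarith, by linarith⟩
  rw [Real.dist_eq, abs_sub_gridCenter u hℓ]
  exact (mul_le_mul_of_nonneg_right abs_le_half hℓ.le).trans_eq (by ring)

theorem gridIndex_eq_of_dist_lt (u : Space n) {ℓ : ℝ} (hℓ : 0 < ℓ) {i : Fin n → ℤ} {y : Space n}
    (h : dist y (gridCenter u ℓ i) < ℓ / 2) : gridIndex u ℓ y = i := by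
  ext c
  have dist_lt := (dist_le_pi_dist y (gridCenter u ℓ i) c).trans_lt h
  rw [Real.dist_eq, abs_lt, gridCenter] at dist_lt
  rw [gridIndex, Int.floor_eq_iff, le_div_iff₀ hℓ, div_lt_iff₀ hℓ]
  constructor <;> linarith [dist_lt.1, dist_lt.2]

theorem measure_gridIndex_ne_top (μ : Measure (Space n)) [IsFiniteMeasureOnCompacts μ]
    (u : Space n) {ℓ : ℝ} (hℓ : 0 < ℓ) (i : Fin n → ℤ) : μ (gridIndex u ℓ ⁻¹' {i}) ≠ ∞ := by
  refine measure_ne_top_of_subset (fun x hx => ?_)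
    (measure_closedBall_lt_top (x := gridCenter u ℓ i) (r := ℓ / 2)).ne
  rw [Metric.mem_closedBall, ← show gridIndex u ℓ x = i from hx]
  exact dist_gridCenter_le u hℓ x

theorem IsInner.gridIndex_eq {u : Space n} {ℓ ε : ℝ} (hℓ : 0 < ℓ) {x y : Space n}
    (hx : IsInner u ℓ ε x) (h : dist x y < ε * ℓ) : gridIndex u ℓ y = gridIndex u ℓ x := by
  refine gridIndex_eq_of_dist_lt u hℓ ?_
  have := dist_triangle_left y (gridCenter u ℓ (gridIndex u ℓ x)) x
  rw [IsInner] at hx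
  linarith

theorem IsInner.ball_subset {u : Space n} {ℓ ε r ρ : ℝ} {x : Space n}
    (hx : IsInner u ℓ ε x) (h : r + ρ ≤ ε * ℓ) :
    Metric.ball x r ⊆ Metric.closedBall (gridCenter u ℓ (gridIndex u ℓ x)) (ℓ / 2 - ρ) := by
  refine (Metric.ball_subset_ball' ?_).trans Metric.ball_subset_closedBall
  rw [IsInner] at hx
  linarith

theorem measurable_gridCenter_gridIndex (ℓ : ℝ) :
    Measurable fun p : Space n × Space n => gridCenter p.1 ℓ (gridIndex p.1 ℓ p.2) := by
  refine measurable_pi_lambda _ fun c => ?_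
  have measurable_floor :
      Measurable fun p : Space n × Space n => ((⌊(p.2 c - p.1 c) / ℓ⌋ : ℤ) : ℝ) :=
    (measurable_of_countable Int.cast).comp (Int.measurable_floor.comp (by fun_prop))
  simp only [gridCenter, gridIndex]
  fun_prop

theorem measurableSet_isInner (ℓ ε : ℝ) :
    MeasurableSet {p : Space n × Space n | IsInner p.1 ℓ ε p.2} :=
  measurableSet_le (measurable_snd.dist (measurable_gridCenter_gridIndex ℓ)) measurable_const

theorem exists_abs_sub_round_lt_of_not_isInner {u : Space n} {ℓ ε : ℝ} (hℓ : 0 < ℓ)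
    (hε : ε ≤ 1 / 2) {x : Space n} (hx : ¬ IsInner u ℓ ε x) :
    ∃ c, |(x c - u c) / ℓ - round ((x c - u c) / ℓ)| < ε := by
  contrapose! hx
  refine (dist_pi_le_iff (mul_nonneg (by linarith) hℓ.le)).2 fun c => ?_
  have dist_boundary := hx c
  rw [abs_sub_round_eq_min, le_min_iff] at dist_boundary
  rw [Real.dist_eq, abs_sub_gridCenter u hℓ]
  gcongr
  exact abs_le.2 ⟨by linarith, by linarith⟩

end Grids

section RandomShift

open ProbabilityTheory

variable {n : ℕ}

theorem isProbabilityMeasure_cond_Ico {L : ℝ} (hL : 0 < L) :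
    IsProbabilityMeasure (cond volume (Set.Ico 0 L)) :=
  cond_isProbabilityMeasure_of_finite (by simpa using hL) (by simp)

theorem near_lattice_subset {ℓ : ℝ} (hℓ : 0 < ℓ) (ε x : ℝ) (M : ℕ) :
    Set.Ico 0 (M * ℓ) ∩ {v | |(x - v) / ℓ - round ((x - v) / ℓ)| < ε} ⊆
      ⋃ z ∈ Finset.Icc (round (x / ℓ) - M) (round (x / ℓ)),
        Metric.ball (x - z * ℓ) (ε * ℓ) := by
  rintro v ⟨⟨v_nonneg, v_lt⟩, hv⟩
  have round_le : round ((x - v) / ℓ) ≤ round (x / ℓ) := by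
    rw [round_eq, round_eq]
    gcongr
    linarith
  have le_round : round (x / ℓ) - M ≤ round ((x - v) / ℓ) := by
    rw [← round_sub_natCast, round_eq, round_eq]
    gcongr
    rw [le_div_iff₀ hℓ, sub_mul, div_mul_cancel₀ _ hℓ.ne']
    linarith
  refine Set.mem_biUnion (Finset.mem_coe.2 (Finset.mem_Icc.2 ⟨le_round, round_le⟩)) ?_
  rw [Metric.mem_ball, dist_comm, Real.dist_eq]
  calc |x - round ((x - v) / ℓ) * ℓ - v| = |(x - v) / ℓ - round ((x - v) / ℓ)| * ℓ := by
        rw [← abs_of_pos hℓ, ← abs_mul, abs_of_pos hℓ]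
        congr 1
        field_simp
        ring
    _ < ε * ℓ := by gcongr; exact hv

theorem cond_Ico_near_lattice_le {ℓ ε : ℝ} (hℓ : 0 < ℓ) (hε : 0 ≤ ε) {M : ℕ} (hM : 1 ≤ M)
    (x : ℝ) :
    cond volume (Set.Ico 0 (M * ℓ)) {v | |(x - v) / ℓ - round ((x - v) / ℓ)| < ε} ≤
      ENNReal.ofReal (4 * ε) := by
  have one_le : (1 : ℝ) ≤ M := mod_cast hM
  calc cond volume (Set.Ico 0 (M * ℓ)) {v | |(x - v) / ℓ - round ((x - v) / ℓ)| < ε}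
      ≤ (ENNReal.ofReal (M * ℓ))⁻¹ * ∑ z ∈ Finset.Icc (round (x / ℓ) - M) (round (x / ℓ)),
          volume (Metric.ball (x - z * ℓ) (ε * ℓ)) := by
        rw [cond_apply measurableSet_Ico, Real.volume_Ico, sub_zero]
        gcongr
        exact (measure_mono (near_lattice_subset hℓ ε x M)).trans
          (measure_biUnion_finset_le _ _)
    _ = ENNReal.ofReal ((M * ℓ)⁻¹ * ((M + 1) * (2 * (ε * ℓ)))) := by
        have card_eq : (round (x / ℓ) + 1 - (round (x / ℓ) - M)).toNat = M + 1 := by lia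
        simp only [Real.volume_ball, Finset.sum_const, Int.card_Icc, card_eq, nsmul_eq_mul]
        rw [← ENNReal.ofReal_inv_of_pos (by positivity), ← ENNReal.ofReal_natCast,
          ← ENNReal.ofReal_mul (by positivity), ← ENNReal.ofReal_mul (by positivity)]
        push_cast
        rfl
    _ ≤ ENNReal.ofReal (4 * ε) := by
        refine ENNReal.ofReal_le_ofReal ?_
        rw [inv_mul_le_iff₀ (by positivity)]
        have : 0 ≤ ε * ℓ := by positivity
        nlinarith

/-- The distribution of the random shift of the grids, uniform on `[0, L) ^ n`. -/
noncomputable def shiftMeasure (n : ℕ) (L : ℝ) : Measure (Space n) :=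
  Measure.pi fun _ => cond volume (Set.Ico 0 L)

theorem isProbabilityMeasure_shiftMeasure {L : ℝ} (hL : 0 < L) :
    IsProbabilityMeasure (shiftMeasure n L) := by
  have := isProbabilityMeasure_cond_Ico hL
  rw [shiftMeasure]
  infer_instance

theorem shiftMeasure_not_isInner_le {ℓ ε : ℝ} (hℓ : 0 < ℓ) (hε : 0 ≤ ε) (hε' : ε ≤ 1 / 2) {M : ℕ}
    (hM : 1 ≤ M) (x : Space n) :
    shiftMeasure n (M * ℓ) {u | ¬ IsInner u ℓ ε x} ≤ n * ENNReal.ofReal (4 * ε) := by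
  have : 0 < (M : ℝ) := mod_cast hM
  have := isProbabilityMeasure_cond_Ico (L := M * ℓ) (by positivity)
  calc shiftMeasure n (M * ℓ) {u | ¬ IsInner u ℓ ε x}
      ≤ shiftMeasure n (M * ℓ) (⋃ c, Function.eval c ⁻¹'
          {v | |(x c - v) / ℓ - round ((x c - v) / ℓ)| < ε}) :=
        measure_mono fun u hu =>
          Set.mem_iUnion.2 (exists_abs_sub_round_lt_of_not_isInner hℓ hε' hu)
    _ ≤ ∑ c, shiftMeasure n (M * ℓ) (Function.eval c ⁻¹'
          {v | |(x c - v) / ℓ - round ((x c - v) / ℓ)| < ε}) := measure_iUnion_fintype_le _ _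
    _ = ∑ c, cond volume (Set.Ico 0 (M * ℓ))
          {v | |(x c - v) / ℓ - round ((x c - v) / ℓ)| < ε} := by
        refine Finset.sum_congr rfl fun c _ => ?_
        refine (measurePreserving_eval (fun _ : Fin n => cond volume (Set.Ico 0 (M * ℓ)))
          c).measure_preimage (measurableSet_lt ?_ measurable_const).nullMeasurableSet
        have measurable_round : Measurable fun v : ℝ => ((round ((x c - v) / ℓ) : ℤ) : ℝ) := by
          simp only [round_eq]
          exact (measurable_of_countable Int.cast).comp (Int.measurable_floor.comp (by fun_prop))
        fun_prop
    _ ≤ ∑ _c : Fin n, ENNReal.ofReal (4 * ε) :=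
        Finset.sum_le_sum fun c _ => cond_Ico_near_lattice_le hℓ hε hM (x c)
    _ = n * ENNReal.ofReal (4 * ε) := by simp

end RandomShift

section GoodPoints

variable {n : ℕ}

/-- The relative distance that a good point at level `k` keeps from the boundaries of the cubes
of level `i`. It decays more slowly than the ratio `2 ^ (k - i)` of the meshes, and its sum over
`i` is small enough for points to be good with probability at least `1 / 2`. -/
noncomputable def margin (n k i : ℕ) : ℝ := (32 * (n + 1) : ℝ)⁻¹ * (3 / 4) ^ (i - k)

/-- The points that stay away from the boundaries of the grids of levels `k, …, N`. -/
def IsGood (u : Space n) (δ : ℝ) (N k : ℕ) (x : Space n) : Prop :=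
  ∀ i ∈ Finset.Icc k N, IsInner u (δ * 2 ^ i) (margin n k i) x

theorem margin_pos (n k i : ℕ) : 0 < margin n k i := by
  rw [margin]
  positivity

theorem margin_le_half (n k i : ℕ) : margin n k i ≤ 1 / 2 := by
  have : (32 * (n + 1) : ℝ)⁻¹ ≤ 1 / 2 := by
    rw [inv_le_comm₀ (by positivity) (by positivity)]
    linarith [n.cast_nonneg (α := ℝ)]
  exact (mul_le_of_le_one_right (by positivity)
    (pow_le_one₀ (by norm_num) (by norm_num))).trans this

theorem sum_margin_le (n k N : ℕ) : n * ∑ i ∈ Finset.Icc k N, 4 * margin n k i ≤ 1 / 2 := by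
  have geometric : ∑ i ∈ Finset.Icc k N, (3 / 4 : ℝ) ^ (i - k) ≤ 4 := by
    rw [← Finset.Ico_add_one_right_eq_Icc, Finset.sum_Ico_eq_sum_range]
    simp only [Nat.add_sub_cancel_left]
    refine (Summable.sum_le_tsum _ (fun i _ => by positivity)
      (summable_geometric_of_lt_one (by norm_num) (by norm_num))).trans_eq ?_
    rw [tsum_geometric_of_lt_one (by norm_num) (by norm_num)]
    norm_num
  simp only [margin, ← Finset.mul_sum]
  calc (n : ℝ) * (4 * ((32 * (n + 1) : ℝ)⁻¹ * ∑ i ∈ Finset.Icc k N, (3 / 4 : ℝ) ^ (i - k)))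
      ≤ n * (4 * ((32 * (n + 1) : ℝ)⁻¹ * 4)) := by gcongr
    _ = 1 / 2 * (n / (n + 1)) := by
        field_simp
        ring
    _ ≤ 1 / 2 := mul_le_of_le_one_right (by norm_num) ((div_le_one (by positivity)).2 (by linarith))

theorem measurableSet_isGood_prod (δ : ℝ) (N k : ℕ) :
    MeasurableSet {p : Space n × Space n | IsGood p.1 δ N k p.2} := by
  simp only [IsGood, Set.ofPred_forall]
  exact .iInter fun i => .iInter fun _ => measurableSet_isInner _ _

theorem measurableSet_isGood (u : Space n) (δ : ℝ) (N k : ℕ) :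
    MeasurableSet {x | IsGood u δ N k x} :=
  measurable_prodMk_left (measurableSet_isGood_prod δ N k)

theorem shiftMeasure_not_isGood_le {δ : ℝ} (hδ : 0 < δ) (N k : ℕ) (x : Space n) :
    shiftMeasure n (δ * 2 ^ N) {u | ¬ IsGood u δ N k x} ≤ 1 / 2 := by
  have bad_eq : {u | ¬ IsGood u δ N k x} =
      ⋃ i ∈ Finset.Icc k N, {u | ¬ IsInner u (δ * 2 ^ i) (margin n k i) x} := by
    ext u
    simp only [IsGood, Set.mem_ofPred_eq, not_forall, Set.mem_iUnion]
  calc shiftMeasure n (δ * 2 ^ N) {u | ¬ IsGood u δ N k x}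
      ≤ ∑ i ∈ Finset.Icc k N, shiftMeasure n (δ * 2 ^ N)
          {u | ¬ IsInner u (δ * 2 ^ i) (margin n k i) x} := by
        rw [bad_eq]
        exact measure_biUnion_finset_le _ _
    _ ≤ ∑ i ∈ Finset.Icc k N, n * ENNReal.ofReal (4 * margin n k i) := by
        refine Finset.sum_le_sum fun i hi => ?_
        have length_eq : δ * 2 ^ N = (2 ^ (N - i) : ℕ) * (δ * 2 ^ i) := by
          rw [Nat.cast_pow, Nat.cast_ofNat, mul_left_comm, ← pow_add,
            Nat.sub_add_cancel (Finset.mem_Icc.1 hi).2]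
        rw [length_eq]
        exact shiftMeasure_not_isInner_le (by positivity) (margin_pos n k i).le
          (margin_le_half n k i) Nat.one_le_two_pow x
    _ = ENNReal.ofReal (n * ∑ i ∈ Finset.Icc k N, 4 * margin n k i) := by
        rw [← Finset.mul_sum, ENNReal.ofReal_mul n.cast_nonneg, ENNReal.ofReal_natCast,
          ENNReal.ofReal_sum_of_nonneg fun i _ => by have := margin_pos n k i; positivity]
    _ ≤ 1 / 2 := (ENNReal.ofReal_le_ofReal (sum_margin_le n k N)).trans_eq (by simp)

theorem half_le_shiftMeasure_isGood {δ : ℝ} (hδ : 0 < δ) (N k : ℕ) (x : Space n) :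
    1 / 2 ≤ shiftMeasure n (δ * 2 ^ N) {u | IsGood u δ N k x} := by
  have := isProbabilityMeasure_shiftMeasure (n := n) (L := δ * 2 ^ N) (by positivity)
  have measurableSet_good : MeasurableSet {u | IsGood u δ N k x} :=
    measurable_prodMk_right (measurableSet_isGood_prod δ N k)
  refine ENNReal.le_of_add_le_add_right (a := 1 / 2) (by simp) ?_
  calc (1 / 2 : ℝ≥0∞) + 1 / 2 = 1 := ENNReal.add_halves 1
    _ = shiftMeasure n (δ * 2 ^ N) {u | IsGood u δ N k x} +
        shiftMeasure n (δ * 2 ^ N) {u | IsGood u δ N k x}ᶜ :=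
      (prob_add_prob_compl measurableSet_good).symm
    _ ≤ _ := by
      gcongr
      exact shiftMeasure_not_isGood_le hδ N k x

end GoodPoints

section Martingale

variable {X ι 𝕜 : Type*} {q : ℕ → X → ι} {r : ℕ → ι → ι}

theorem fiber_congr_of_le (hr : ∀ j, q (j + 1) = r j ∘ q j) {i j : ℕ} (hij : i ≤ j) {x y : X}
    (h : q i x = q i y) : q j x = q j y := by
  induction j, hij using Nat.le_induction with
  | base => exact h
  | succ j _ ih => rw [hr, Function.comp_apply, Function.comp_apply, ih]

variable [MeasurableSpace X] [RCLike 𝕜] {μ : Measure X}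

/-- The averages of `f` over the coarser and coarser partitions into fibres of `q 0, q 1, …`,
shifted so that stage `0` is `f` itself. -/
noncomputable def successiveAverage (μ : Measure X) (q : ℕ → X → ι) (f : X → 𝕜) : ℕ → X → 𝕜
  | 0 => f
  | j + 1 => fiberAverage μ (q j) (successiveAverage μ q f j)

/-- The counterpart of `successiveAverage` for `[0, ∞]`-valued functions. -/
noncomputable def successiveLAverage (μ : Measure X) (q : ℕ → X → ι) (F : X → ℝ≥0∞) :
    ℕ → X → ℝ≥0∞
  | 0 => F
  | j + 1 => fiberLAverage μ (q j) (successiveLAverage μ q F j)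

/-- The terms of the telescoping decomposition of `f` into differences of successive averages. The
top average, which is not a difference, is the term of index `N + 1`. -/
noncomputable def martingaleDifference (μ : Measure X) (q : ℕ → X → ι) (f : X → 𝕜) (N j : ℕ)
    (x : X) : 𝕜 :=
  if j ≤ N then successiveAverage μ q f j x - successiveAverage μ q f (j + 1) x
  else successiveAverage μ q f (N + 1) x

theorem enorm_successiveAverage_le (f : X → 𝕜) (j : ℕ) (x : X) :
    ‖successiveAverage μ q f j x‖ₑ ≤ successiveLAverage μ q (fun y => ‖f y‖ₑ) j x := by
  induction j generalizing x with
  | zero => exact le_rfl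
  | succ j ih => exact enorm_fiberAverage_le ih x

theorem successiveAverage_congr (hr : ∀ j, q (j + 1) = r j ∘ q j) (f : X → 𝕜) {i j : ℕ}
    (hij : i < j) {x y : X} (h : q i x = q i y) :
    successiveAverage μ q f j x = successiveAverage μ q f j y := by
  obtain ⟨j, rfl⟩ := Nat.exists_eq_succ_of_ne_zero (Nat.ne_zero_of_lt hij)
  exact fiberAverage_congr (fiber_congr_of_le hr (Nat.lt_succ_iff.1 hij) h)

theorem martingaleDifference_congr (hr : ∀ j, q (j + 1) = r j ∘ q j) (f : X → 𝕜) {N i j : ℕ}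
    (hij : i < j) (hiN : i ≤ N) {x y : X} (h : q i x = q i y) :
    martingaleDifference μ q f N j x = martingaleDifference μ q f N j y := by
  unfold martingaleDifference
  rw [successiveAverage_congr hr f hij h, successiveAverage_congr hr f (hij.trans j.lt_succ_self) h,
    successiveAverage_congr hr f (Nat.lt_succ_of_le hiN) h]

theorem sum_martingaleDifference (f : X → 𝕜) {N k : ℕ} (hk : k ≤ N + 1) (x : X) :
    ∑ j ∈ Finset.Ico k (N + 2), martingaleDifference μ q f N j x = successiveAverage μ q f k x := by
  have differences : ∑ j ∈ Finset.Ico k (N + 1), martingaleDifference μ q f N j x =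
      ∑ j ∈ Finset.Ico k (N + 1),
        (successiveAverage μ q f j x - successiveAverage μ q f (j + 1) x) :=
    Finset.sum_congr rfl fun j hj =>
      if_pos (Nat.lt_succ_iff.1 (Finset.mem_Ico.1 hj).2)
  have top : martingaleDifference μ q f N (N + 1) x = successiveAverage μ q f (N + 1) x :=
    if_neg (by omega)
  have telescope := Finset.sum_Ico_sub (fun j => -successiveAverage μ q f j x) hk
  simp only [neg_sub_neg] at telescope
  rw [Finset.sum_Ico_succ_top hk, differences, top, telescope]
  ring

variable [MeasurableSpace ι] [MeasurableSingletonClass ι]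

theorem setIntegral_martingaleDifference_eq_zero (hq : ∀ j, Measurable (q j))
    (hfin : ∀ j i, μ (q j ⁻¹' {i}) ≠ ∞) (f : X → 𝕜) {N j : ℕ} (hj : j ≤ N) (i : ι) :
    ∫ x in q j ⁻¹' {i}, martingaleDifference μ q f N j x ∂μ = 0 := by
  simp only [martingaleDifference, if_pos hj]
  exact setIntegral_sub_fiberAverage_eq_zero (hq j) (hfin j) (successiveAverage μ q f j) i

variable [Countable ι]

theorem measurable_successiveAverage (hq : ∀ j, Measurable (q j)) {f : X → 𝕜} (hf : Measurable f)
    (j : ℕ) : Measurable (successiveAverage μ q f j) := by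
  cases j with
  | zero => exact hf
  | succ j => exact measurable_fiberAverage (hq j) _

theorem measurable_successiveLAverage (hq : ∀ j, Measurable (q j)) {F : X → ℝ≥0∞}
    (hF : Measurable F) (j : ℕ) : Measurable (successiveLAverage μ q F j) := by
  cases j with
  | zero => exact hF
  | succ j => exact measurable_fiberLAverage (hq j) _

theorem memLp_successiveAverage (hq : ∀ j, Measurable (q j)) (hfin : ∀ j i, μ (q j ⁻¹' {i}) ≠ ∞)
    {f : X → 𝕜} (hf : MemLp f 2 μ) (j : ℕ) : MemLp (successiveAverage μ q f j) 2 μ := by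
  induction j with
  | zero => exact hf
  | succ j ih => exact memLp_fiberAverage (hq j) (hfin j) ih

theorem measurable_martingaleDifference (hq : ∀ j, Measurable (q j)) {f : X → 𝕜}
    (hf : Measurable f) (N j : ℕ) : Measurable (martingaleDifference μ q f N j) := by
  have measurable_average := measurable_successiveAverage (μ := μ) hq hf
  unfold martingaleDifference
  split_ifs
  · exact (measurable_average j).sub (measurable_average (j + 1))
  · exact measurable_average (N + 1)

theorem memLp_martingaleDifference (hq : ∀ j, Measurable (q j))
    (hfin : ∀ j i, μ (q j ⁻¹' {i}) ≠ ∞) {f : X → 𝕜} (hf : MemLp f 2 μ) (N j : ℕ) :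
    MemLp (martingaleDifference μ q f N j) 2 μ := by
  have memLp_average := memLp_successiveAverage hq hfin hf
  unfold martingaleDifference
  split_ifs
  · exact (memLp_average j).sub (memLp_average (j + 1))
  · exact memLp_average (N + 1)

theorem sum_lintegral_martingaleDifference_sq (hq : ∀ j, Measurable (q j))
    (hfin : ∀ j i, μ (q j ⁻¹' {i}) ≠ ∞) {f : X → 𝕜} (hf : MemLp f 2 μ) (N : ℕ) :
    ∑ j ∈ Finset.range (N + 2), ∫⁻ x, ‖martingaleDifference μ q f N j x‖ₑ ^ 2 ∂μ =
      ∫⁻ x, ‖f x‖ₑ ^ 2 ∂μ := by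
  have orthogonal_sum (m : ℕ) : ∑ j ∈ Finset.range m,
      ∫⁻ x, ‖successiveAverage μ q f j x - successiveAverage μ q f (j + 1) x‖ₑ ^ 2 ∂μ +
        ∫⁻ x, ‖successiveAverage μ q f m x‖ₑ ^ 2 ∂μ = ∫⁻ x, ‖f x‖ₑ ^ 2 ∂μ := by
    induction m with
    | zero => simp [successiveAverage]
    | succ m ih =>
      rw [← ih, Finset.sum_range_succ, add_assoc, ← lintegral_fiberAverage_sq_add (hq m) (hfin m)
        (memLp_successiveAverage hq hfin hf m), add_comm (lintegral μ _)]
      rfl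
  rw [Finset.sum_range_succ, ← orthogonal_sum (N + 1)]
  congr 1
  · refine Finset.sum_congr rfl fun j hj => ?_
    simp only [martingaleDifference, if_pos (Nat.lt_succ_iff.1 (Finset.mem_range.1 hj))]
  · simp [martingaleDifference]

/-- The mean over the fibres of `q i` of the weights of index at most `i`, as the term of index
`i + 1`; the packing condition of the Carleson embedding theorem bounds it. -/
noncomputable def packingAverage (μ : Measure X) (q : ℕ → X → ι) (w : ℕ → X → ℝ≥0∞) :
    ℕ → X → ℝ≥0∞
  | 0 => 0
  | i + 1 => fiberLAverage μ (q i) (fun y => ∑ k ∈ Finset.range (i + 1), w k y)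

theorem measurable_packingAverage (hq : ∀ j, Measurable (q j)) (w : ℕ → X → ℝ≥0∞) (i : ℕ) :
    Measurable (packingAverage μ q w i) := by
  cases i with
  | zero => exact measurable_const
  | succ i => exact measurable_fiberLAverage (hq i) _

theorem fiberLAverage_packingAverage_add (hq : ∀ j, Measurable (q j))
    (hfin : ∀ j i, μ (q j ⁻¹' {i}) ≠ ∞) (hr : ∀ j, q (j + 1) = r j ∘ q j) {w : ℕ → X → ℝ≥0∞}
    (hw : ∀ k, Measurable (w k)) (i : ℕ) :
    fiberLAverage μ (q i) (fun y => packingAverage μ q w i y + w i y) =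
      packingAverage μ q w (i + 1) := by
  cases i with
  | zero => simp [packingAverage]
  | succ i =>
    have add_weight {a : X → ℝ≥0∞} (ha : Measurable a) :
        fiberLAverage μ (q (i + 1)) (fun y => a y + w (i + 1) y) =
          fiberLAverage μ (q (i + 1)) a + fiberLAverage μ (q (i + 1)) (w (i + 1)) := by
      ext x
      exact lintegral_add_left ha _
    have coarsen := fiberLAverage_comp_fiberLAverage (hq i) (hfin i) (r i)
      fun y => ∑ k ∈ Finset.range (i + 1), w k y
    rw [← hr] at coarsen
    rw [add_weight (measurable_packingAverage hq w (i + 1)), packingAverage, coarsen,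
      packingAverage, ← add_weight (Finset.measurable_sum _ fun k _ => hw k)]
    simp only [Finset.sum_range_succ _ (i + 1)]

theorem carleson_embedding (hq : ∀ j, Measurable (q j)) (hfin : ∀ j i, μ (q j ⁻¹' {i}) ≠ ∞)
    (hr : ∀ j, q (j + 1) = r j ∘ q j) {w : ℕ → X → ℝ≥0∞} (hw : ∀ k, Measurable (w k)) {m : ℕ}
    (hC : ∀ i ≤ m, ∀ x, packingAverage μ q w i x ≤ 1) {F : X → ℝ≥0∞} (hF : Measurable F) :
    ∑ k ∈ Finset.range m, ∫⁻ x, successiveLAverage μ q F (k + 1) x ^ 2 * w k x ∂μ ≤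
      4 * ∫⁻ x, F x ^ 2 ∂μ := by
  suffices bellman : ∀ i ≤ m,
      ∑ k ∈ Finset.range i, ∫⁻ x, successiveLAverage μ q F (k + 1) x ^ 2 * w k x ∂μ +
        4 * ∫⁻ x, successiveLAverage μ q F i x ^ 2 * (1 + packingAverage μ q w i x)⁻¹ ∂μ ≤
      4 * ∫⁻ x, F x ^ 2 ∂μ from le_self_add.trans (bellman m le_rfl)
  intro i hi
  induction i with
  | zero => simp [successiveLAverage, packingAverage]
  | succ i ih =>
    refine le_trans ?_ (ih (by omega))
    rw [Finset.sum_range_succ, add_assoc]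
    gcongr
    have bellman_step := lintegral_mul_sq_fiberLAverage_add_le (hq i) (hfin i)
      (measurable_successiveLAverage (μ := μ) hq hF i).aemeasurable (hw i)
      (measurable_packingAverage hq w i) (hC i (by omega))
      (by rw [fiberLAverage_packingAverage_add hq hfin hr hw]; exact hC (i + 1) hi)
    rwa [fiberLAverage_packingAverage_add hq hfin hr hw] at bellman_step

end Martingale

section Decay

theorem sum_range_pow_dist_le (τ : ℝ≥0∞) (k m : ℕ) :
    ∑ j ∈ Finset.range m, τ ^ Nat.dist k j ≤ 2 * (1 - τ)⁻¹ := by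
  have geometric (S : Finset ℕ) : ∑ j ∈ S, τ ^ j ≤ (1 - τ)⁻¹ := by
    rw [← ENNReal.tsum_geometric]
    exact ENNReal.sum_le_tsum _
  have below : ∑ j ∈ Finset.range m with j ≤ k, τ ^ Nat.dist k j ≤ (1 - τ)⁻¹ := by
    refine le_trans (le_of_eq ?_) (geometric (({j ∈ Finset.range m | j ≤ k}).image (k - ·)))
    rw [Finset.sum_image fun i hi j hj h => by simp at hi hj h; omega]
    exact Finset.sum_congr rfl fun j hj => by
      rw [Nat.dist_eq_sub_of_le_right (Finset.mem_filter.1 hj).2]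
  have above : ∑ j ∈ Finset.range m with ¬ j ≤ k, τ ^ Nat.dist k j ≤ (1 - τ)⁻¹ := by
    refine le_trans (le_of_eq ?_) (geometric (({j ∈ Finset.range m | ¬ j ≤ k}).image (· - k)))
    rw [Finset.sum_image fun i hi j hj h => by simp at hi hj h; omega]
    exact Finset.sum_congr rfl fun j hj => by
      rw [Nat.dist_eq_sub_of_le (not_le.1 (Finset.mem_filter.1 hj).2).le]
  rw [← Finset.sum_filter_add_sum_filter_not _ (· ≤ k), two_mul]
  exact add_le_add below above

theorem enorm_sum_sq_le {E κ : Type*} [SeminormedAddCommGroup E] (S : Finset κ) (b : κ → E)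
    {w : κ → ℝ≥0} (hw : ∀ j ∈ S, w j ≠ 0) :
    ‖∑ j ∈ S, b j‖ₑ ^ 2 ≤ (∑ j ∈ S, (w j : ℝ≥0∞)) * ∑ j ∈ S, (w j : ℝ≥0∞)⁻¹ * ‖b j‖ₑ ^ 2 := by
  have cauchy_schwarz : ‖∑ j ∈ S, b j‖₊ ^ 2 ≤
      (∑ j ∈ S, w j) * ∑ j ∈ S, (w j)⁻¹ * ‖b j‖₊ ^ 2 :=
    (pow_le_pow_left' (nnnorm_sum_le S b) 2).trans <|
      Finset.sum_sq_le_sum_mul_sum_of_sq_le_mul S (fun _ _ => zero_le) (fun _ _ => zero_le)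
        fun j hj => by rw [mul_inv_cancel_left₀ (hw j hj)]
  have inv_eq : ∑ j ∈ S, (w j : ℝ≥0∞)⁻¹ * ‖b j‖ₑ ^ 2 =
      ((∑ j ∈ S, (w j)⁻¹ * ‖b j‖₊ ^ 2 : ℝ≥0) : ℝ≥0∞) := by
    push_cast
    exact Finset.sum_congr rfl fun j hj => by rw [ENNReal.coe_inv (hw j hj), enorm_eq_nnnorm]
  rw [inv_eq, enorm_eq_nnnorm]
  exact_mod_cast cauchy_schwarz

theorem lintegral_enorm_sum_sq_le {X E κ : Type*} [MeasurableSpace X] {μ : Measure X}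
    [SeminormedAddCommGroup E] {S : Finset κ} {b : κ → X → E} {w : κ → ℝ≥0} {H : κ → ℝ≥0∞}
    (hb : ∀ j, Measurable fun x => ‖b j x‖ₑ) (hw : ∀ j ∈ S, w j ≠ 0)
    (hH : ∀ j ∈ S, ∫⁻ x, ‖b j x‖ₑ ^ 2 ∂μ ≤ (w j : ℝ≥0∞) ^ 2 * H j) :
    ∫⁻ x, ‖∑ j ∈ S, b j x‖ₑ ^ 2 ∂μ ≤ (∑ j ∈ S, (w j : ℝ≥0∞)) * ∑ j ∈ S, w j * H j := by
  calc ∫⁻ x, ‖∑ j ∈ S, b j x‖ₑ ^ 2 ∂μ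
      ≤ ∫⁻ x, (∑ j ∈ S, (w j : ℝ≥0∞)) * ∑ j ∈ S, (w j : ℝ≥0∞)⁻¹ * ‖b j x‖ₑ ^ 2 ∂μ :=
        lintegral_mono fun x => enorm_sum_sq_le S _ hw
    _ = (∑ j ∈ S, (w j : ℝ≥0∞)) * ∑ j ∈ S, (w j : ℝ≥0∞)⁻¹ * ∫⁻ x, ‖b j x‖ₑ ^ 2 ∂μ := by
        rw [lintegral_const_mul _ (by fun_prop), lintegral_finsetSum _ fun j _ => by fun_prop]
        simp only [lintegral_const_mul _ ((hb _).pow_const 2)]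
    _ ≤ (∑ j ∈ S, (w j : ℝ≥0∞)) * ∑ j ∈ S, w j * H j := by
        gcongr _ * ?_
        refine Finset.sum_le_sum fun j hj => ?_
        calc (w j : ℝ≥0∞)⁻¹ * ∫⁻ x, ‖b j x‖ₑ ^ 2 ∂μ ≤ (w j : ℝ≥0∞)⁻¹ * (w j ^ 2 * H j) :=
              mul_le_mul_right (hH j hj) _
          _ = w j * H j := by
              rw [sq, mul_assoc, ENNReal.inv_mul_cancel_left
                (fun h => hw j hj (by exact_mod_cast h)) ENNReal.coe_ne_top]

end Decay

section Levels

variable {n : ℕ} {δ : ℝ}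

/-- The nested grids of meshes `δ * 2 ^ i`. -/
noncomputable def grid (u : Space n) (δ : ℝ) (i : ℕ) : Space n → Fin n → ℤ :=
  gridIndex u (δ * 2 ^ i)

/-- The index of the parent of a grid cube. -/
def parentIndex (i : Fin n → ℤ) : Fin n → ℤ := fun c => i c / 2

theorem measurable_grid (u : Space n) (δ : ℝ) (i : ℕ) : Measurable (grid u δ i) :=
  measurable_gridIndex u _

theorem measure_grid_ne_top (μ : Measure (Space n)) [IsFiniteMeasureOnCompacts μ] (u : Space n)
    (hδ : 0 < δ) (i : ℕ) (c : Fin n → ℤ) : μ (grid u δ i ⁻¹' {c}) ≠ ∞ :=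
  measure_gridIndex_ne_top μ u (by positivity) c

theorem grid_succ (u : Space n) (δ : ℝ) (i : ℕ) :
    grid u δ (i + 1) = parentIndex ∘ grid u δ i := by
  ext1 x
  rw [grid, pow_succ, ← mul_assoc, mul_comm _ (2 : ℝ), gridIndex_two_mul]
  rfl

/-- The scales `t` that are treated by means of the grid of mesh `δ * 2 ^ k`. -/
def levelInterval (δ : ℝ) (k : ℕ) : Set ℝ := Set.Ico (δ * 2 ^ k / 4) (δ * 2 ^ k / 2)

theorem pos_of_mem_levelInterval (hδ : 0 < δ) {k : ℕ} {t : ℝ} (ht : t ∈ levelInterval δ k) :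
    0 < t :=
  lt_of_lt_of_le (by positivity) ht.1

theorem div_margin_mul_le (n : ℕ) (hδ : 0 < δ) {k i : ℕ} (hki : k ≤ i) {t : ℝ}
    (ht : t ∈ levelInterval δ k) :
    t / (margin n k i * (δ * 2 ^ i)) ≤ 16 * (n + 1) * (2 / 3) ^ (i - k) := by
  obtain ⟨m, rfl⟩ := Nat.exists_eq_add_of_le hki
  have ratio : (2 / 3 : ℝ) ^ m * ((3 / 4) ^ m * 2 ^ m) = 1 := by
    rw [← mul_pow, ← mul_pow]
    norm_num
  rw [div_le_iff₀ (by have := margin_pos n k (k + m); positivity), margin, Nat.add_sub_cancel_left]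
  calc t ≤ δ * 2 ^ k / 2 * ((2 / 3) ^ m * ((3 / 4) ^ m * 2 ^ m)) := by
        rw [ratio, mul_one]
        exact ht.2.le
    _ = 16 * (n + 1) * (2 / 3) ^ m * ((32 * (n + 1) : ℝ)⁻¹ * (3 / 4) ^ m * (δ * 2 ^ (k + m))) := by
        rw [pow_add]
        field_simp
        ring

theorem mesh_div_le (hδ : 0 < δ) {j k : ℕ} (hjk : j ≤ k) {t : ℝ} (ht : t ∈ levelInterval δ k) :
    δ * 2 ^ j / t ≤ 4 * (2 / 3) ^ (k - j) := by
  obtain ⟨m, rfl⟩ := Nat.exists_eq_add_of_le hjk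
  have one_le_ratio : (1 : ℝ) ≤ (2 / 3) ^ m * 2 ^ m := by
    rw [← mul_pow]
    exact one_le_pow₀ (by norm_num)
  rw [div_le_iff₀ (pos_of_mem_levelInterval hδ ht), Nat.add_sub_cancel_left]
  calc δ * 2 ^ j ≤ δ * 2 ^ j * ((2 / 3) ^ m * 2 ^ m) :=
        le_mul_of_one_le_right (by positivity) one_le_ratio
    _ = 4 * (2 / 3) ^ m * (δ * 2 ^ (j + m) / 4) := by ring
    _ ≤ 4 * (2 / 3) ^ m * t := by
        gcongr
        exact ht.1

/-- The geometric rate at which the interaction of two levels decays with their distance. -/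
noncomputable def decay (α : ℝ) : ℝ≥0 := ((2 / 3 : ℝ) ^ α).toNNReal

/-- A bound for the sum of `decay α ^ Nat.dist k j` over `j`. -/
noncomputable def decaySum (α : ℝ) : ℝ≥0 := 2 * (1 - decay α)⁻¹

/-- The common constant of the off-diagonal estimates, for kernels majorized with constant `C`. -/
noncomputable def offDiagConst (n : ℕ) (α : ℝ) (C : ℝ≥0) : ℝ≥0 :=
  C * ((32 * (n + 1) : ℝ) ^ α).toNNReal * majorantBound α

theorem decay_ne_zero (α : ℝ) : decay α ≠ 0 := by
  rw [decay, Ne, Real.toNNReal_eq_zero, not_le]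
  positivity

theorem decay_lt_one {α : ℝ} (hα : 0 < α) : decay α < 1 := by
  rw [decay, Real.toNNReal_lt_one]
  exact Real.rpow_lt_one (by norm_num) (by norm_num) hα

theorem sum_range_decay_pow_dist_le {α : ℝ} (hα : 0 < α) (k m : ℕ) :
    ∑ j ∈ Finset.range m, (decay α : ℝ≥0∞) ^ Nat.dist k j ≤ decaySum α := by
  refine (sum_range_pow_dist_le _ k m).trans_eq ?_
  rw [decaySum, ENNReal.coe_mul, ENNReal.coe_inv (tsub_pos_of_lt (decay_lt_one hα)).ne',
    ENNReal.coe_sub, ENNReal.coe_one, ENNReal.coe_ofNat]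

theorem mul_ofReal_rpow_mul_majorantBound_le {α : ℝ} (hα : 0 < α) (C : ℝ≥0) {a : ℝ} (ha : 0 ≤ a)
    {d : ℕ} (had : a ≤ 32 * (n + 1) * (2 / 3) ^ d) :
    C * ENNReal.ofReal (a ^ α) * majorantBound α ≤ offDiagConst n α C * decay α ^ d := by
  have rpow_le : a ^ α ≤ (32 * (n + 1) : ℝ) ^ α * ((2 / 3 : ℝ) ^ α) ^ d := by
    refine (Real.rpow_le_rpow ha had hα.le).trans_eq ?_
    rw [Real.mul_rpow (by positivity) (by positivity), ← Real.rpow_natCast,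
      ← Real.rpow_mul (by norm_num), mul_comm (d : ℝ), Real.rpow_mul (by norm_num),
      Real.rpow_natCast]
  calc C * ENNReal.ofReal (a ^ α) * majorantBound α
      ≤ C * (ENNReal.ofReal ((32 * (n + 1) : ℝ) ^ α) * decay α ^ d) * majorantBound α := by
        gcongr
        refine (ENNReal.ofReal_le_ofReal rpow_le).trans_eq ?_
        rw [ENNReal.ofReal_mul (by positivity), ENNReal.ofReal_pow (by positivity)]
        rfl
    _ = offDiagConst n α C * decay α ^ d := by
        rw [offDiagConst, ENNReal.coe_mul, ENNReal.coe_mul, ENNReal.ofReal]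
        ring

variable {μ : Measure (Space n)} {𝕜 : Type*} [RCLike 𝕜] {α : ℝ} {C : ℝ≥0}
  {s : ℝ → Space n → Space n → 𝕜} {u : Space n}

/-- The contribution to `θ_t f`, for `t` in the level `k`, of the martingale difference of index
`j`. For the coarse levels `k < j` the pointwise product with `θ_t 1` is removed; these products
add up to the paraproduct. -/
noncomputable def levelError (μ : Measure (Space n)) (s : ℝ → Space n → Space n → 𝕜)
    (u : Space n) (δ : ℝ) (N k : ℕ) (t : ℝ) (f : Space n → 𝕜) (j : ℕ) (x : Space n) : 𝕜 :=
  theta μ s t (martingaleDifference μ (grid u δ) f N j) x -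
    if k < j then martingaleDifference μ (grid u δ) f N j x * theta μ s t 1 x else 0

variable [IsFiniteMeasureOnCompacts μ]

namespace IsMajorized

theorem setLIntegral_levelError_sq_le_of_lt (hs : IsMajorized μ α C s) (hα : 0 < α) (hδ : 0 < δ)
    {N k j : ℕ} (hkj : k < j) (hj : j ≤ N + 1) {t : ℝ} (ht : t ∈ levelInterval δ k)
    {f : Space n → 𝕜} (hfm : Measurable f) (hf : MemLp f 2 μ) :
    ∫⁻ x in {x | IsGood u δ N k x}, ‖levelError μ s u δ N k t f j x‖ₑ ^ 2 ∂μ ≤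
      4 * (offDiagConst n α C * decay α ^ (j - k)) ^ 2 *
        ∫⁻ x, ‖martingaleDifference μ (grid u δ) f N j x‖ₑ ^ 2 ∂μ := by
  obtain ⟨i, rfl⟩ := Nat.exists_eq_succ_of_ne_zero (Nat.ne_zero_of_lt hkj)
  have hki : k ≤ i := Nat.lt_succ_iff.1 hkj
  have hiN : i ≤ N := Nat.succ_le_succ_iff.1 hj
  have t_pos := pos_of_mem_levelInterval hδ ht
  have margin_mul_pos : 0 < margin n k i * (δ * 2 ^ i) := by
    have := margin_pos n k i
    positivity
  have locally_constant : ∀ x ∈ {x | IsGood u δ N k x}, ∀ y,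
      dist x y < margin n k i * (δ * 2 ^ i) →
      martingaleDifference μ (grid u δ) f N (i + 1) y =
        martingaleDifference μ (grid u δ) f N (i + 1) x := fun x hx y hxy =>
    martingaleDifference_congr (r := fun _ => parentIndex) (grid_succ u δ) f i.lt_succ_self hiN
      ((hx i (Finset.mem_Icc.2 ⟨hki, hiN⟩)).gridIndex_eq (by positivity) hxy)
  simp only [levelError, if_pos hkj]
  refine (hs.setLIntegral_theta_sub_mul_sq_le hα t_pos margin_mul_pos
    (measurable_martingaleDifference (measurable_grid u δ) hfm N _)
    (memLp_martingaleDifference (measurable_grid u δ) (measure_grid_ne_top μ u hδ) hf N _)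
    (measurableSet_isGood u δ N k) locally_constant).trans ?_
  gcongr 4 * ?_ ^ 2 * _
  refine mul_ofReal_rpow_mul_majorantBound_le hα C (by positivity) ?_
  refine (div_margin_mul_le n hδ hki ht).trans ?_
  rw [Nat.succ_sub hki, pow_succ]
  have : 0 ≤ (n + 1) * (2 / 3 : ℝ) ^ (i - k) := by positivity
  linarith

theorem setLIntegral_levelError_sq_le_of_le (hs : IsMajorized μ α C s) (hα : 0 < α) (hδ : 0 < δ)
    {N k j : ℕ} (hjk : j ≤ k) (hk : k ≤ N) {t : ℝ} (ht : t ∈ levelInterval δ k)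
    {f : Space n → 𝕜} (hfm : Measurable f) (hf : MemLp f 2 μ) :
    ∫⁻ x in {x | IsGood u δ N k x}, ‖levelError μ s u δ N k t f j x‖ₑ ^ 2 ∂μ ≤
      4 * (offDiagConst n α C * decay α ^ (k - j)) ^ 2 *
        ∫⁻ x, ‖martingaleDifference μ (grid u δ) f N j x‖ₑ ^ 2 ∂μ := by
  simp only [levelError, if_neg (not_lt.2 hjk), sub_zero]
  calc ∫⁻ x in {x | IsGood u δ N k x},
        ‖theta μ s t (martingaleDifference μ (grid u δ) f N j) x‖ₑ ^ 2 ∂μ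
      ≤ ∫⁻ x, ‖theta μ s t (martingaleDifference μ (grid u δ) f N j) x‖ₑ ^ 2 ∂μ :=
        setLIntegral_le_lintegral _ _
    _ ≤ (C * ENNReal.ofReal ((2 * (δ * 2 ^ j / 2) / t) ^ α) * majorantBound α) ^ 2 *
          ∫⁻ x, ‖martingaleDifference μ (grid u δ) f N j x‖ₑ ^ 2 ∂μ :=
        hs.lintegral_theta_sq_le_of_mean_zero hα (measurable_grid u δ j)
          (pos_of_mem_levelInterval hδ ht) (dist_gridCenter_le u (by positivity))
          (measurable_martingaleDifference (measurable_grid u δ) hfm N j)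
          (memLp_martingaleDifference (measurable_grid u δ) (measure_grid_ne_top μ u hδ) hf N j)
          (setIntegral_martingaleDifference_eq_zero (measurable_grid u δ)
            (measure_grid_ne_top μ u hδ) f (hjk.trans hk))
    _ ≤ 1 * (offDiagConst n α C * decay α ^ (k - j)) ^ 2 *
          ∫⁻ x, ‖martingaleDifference μ (grid u δ) f N j x‖ₑ ^ 2 ∂μ := by
        rw [one_mul]
        gcongr ?_ ^ 2 * _
        have t_pos := pos_of_mem_levelInterval hδ ht
        refine mul_ofReal_rpow_mul_majorantBound_le hα C (by positivity) ?_
        rw [mul_div_cancel₀ _ (two_ne_zero' ℝ)]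
        refine (mesh_div_le hδ hjk ht).trans ?_
        gcongr
        linarith [n.cast_nonneg (α := ℝ)]
    _ ≤ _ := by
        gcongr
        norm_num

theorem measurable_levelError (hs : IsMajorized μ α C s) {N k j : ℕ} {t : ℝ} {f : Space n → 𝕜}
    (hfm : Measurable f) : Measurable (levelError μ s u δ N k t f j) := by
  have measurable_difference := measurable_martingaleDifference (μ := μ) (measurable_grid u δ)
    hfm N j
  unfold levelError
  split_ifs
  · exact (hs.measurable_theta measurable_difference t).sub
      (measurable_difference.mul (hs.measurable_theta measurable_one t))
  · exact (hs.measurable_theta measurable_difference t).sub measurable_const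

theorem setLIntegral_sum_levelError_sq_le (hs : IsMajorized μ α C s) (hα : 0 < α) (hδ : 0 < δ)
    {N k : ℕ} (hk : k ≤ N) {t : ℝ} (ht : t ∈ levelInterval δ k) {f : Space n → 𝕜}
    (hfm : Measurable f) (hf : MemLp f 2 μ) :
    ∫⁻ x in {x | IsGood u δ N k x},
        ‖∑ j ∈ Finset.range (N + 2), levelError μ s u δ N k t f j x‖ₑ ^ 2 ∂μ ≤
      decaySum α * ∑ j ∈ Finset.range (N + 2), decay α ^ Nat.dist k j *
        (4 * offDiagConst n α C ^ 2 *
          ∫⁻ x, ‖martingaleDifference μ (grid u δ) f N j x‖ₑ ^ 2 ∂μ) := by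
  refine (lintegral_enorm_sum_sq_le (w := fun j => decay α ^ Nat.dist k j)
    (H := fun j => 4 * offDiagConst n α C ^ 2 *
      ∫⁻ x, ‖martingaleDifference μ (grid u δ) f N j x‖ₑ ^ 2 ∂μ)
    (fun j => (hs.measurable_levelError hfm).enorm)
    (fun j _ => pow_ne_zero _ (decay_ne_zero α)) fun j hj => ?_).trans ?_
  · rcases lt_or_ge k j with hkj | hjk
    · refine (hs.setLIntegral_levelError_sq_le_of_lt hα hδ hkj
        (Nat.lt_succ_iff.1 (Finset.mem_range.1 hj)) ht hfm hf).trans_eq ?_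
      rw [Nat.dist_eq_sub_of_le hkj.le, ENNReal.coe_pow]
      ring
    · refine (hs.setLIntegral_levelError_sq_le_of_le hα hδ hjk hk ht hfm hf).trans_eq ?_
      rw [Nat.dist_eq_sub_of_le_right hjk, ENNReal.coe_pow]
      ring
  · simp only [ENNReal.coe_pow]
    gcongr
    exact sum_range_decay_pow_dist_le hα k (N + 2)

theorem theta_eq_add_sum_levelError (hs : IsMajorized μ α C s) (hα : 0 < α) (hδ : 0 < δ)
    {N k : ℕ} (hk : k ≤ N) {t : ℝ} (ht : 0 < t) {f : Space n → 𝕜} (hf : MemLp f 2 μ)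
    (x : Space n) :
    theta μ s t f x = successiveAverage μ (grid u δ) f (k + 1) x * theta μ s t 1 x +
      ∑ j ∈ Finset.range (N + 2), levelError μ s u δ N k t f j x := by
  have theta_decomposition : ∑ j ∈ Finset.range (N + 2),
      theta μ s t (martingaleDifference μ (grid u δ) f N j) x = theta μ s t f x := by
    simp only [theta]
    rw [← integral_finsetSum _ fun j _ => hs.integrable_mul hα ht x
      (memLp_martingaleDifference (measurable_grid u δ) (measure_grid_ne_top μ u hδ) hf N j)]
    refine integral_congr_ae (Filter.Eventually.of_forall fun y => ?_)
    simp only [← Finset.mul_sum, Finset.range_eq_Ico]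
    rw [sum_martingaleDifference f (Nat.zero_le _), successiveAverage]
  have coarse_levels : (Finset.range (N + 2)).filter (k < ·) = Finset.Ico (k + 1) (N + 2) := by
    ext j
    simp only [Finset.mem_filter, Finset.mem_range, Finset.mem_Ico]
    omega
  simp only [levelError]
  rw [Finset.sum_sub_distrib, ← Finset.sum_filter, theta_decomposition, coarse_levels,
    ← Finset.sum_mul, sum_martingaleDifference f (by omega)]
  ring

theorem setLIntegral_theta_sq_le (hs : IsMajorized μ α C s) (hα : 0 < α) (hδ : 0 < δ)
    {N k : ℕ} (hk : k ≤ N) {t : ℝ} (ht : t ∈ levelInterval δ k) {f : Space n → 𝕜}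
    (hfm : Measurable f) (hf : MemLp f 2 μ) :
    ∫⁻ x in {x | IsGood u δ N k x}, ‖theta μ s t f x‖ₑ ^ 2 ∂μ ≤
      2 * ∫⁻ x in {x | IsGood u δ N k x},
        ‖successiveAverage μ (grid u δ) f (k + 1) x‖ₑ ^ 2 * ‖theta μ s t 1 x‖ₑ ^ 2 ∂μ +
      8 * offDiagConst n α C ^ 2 * decaySum α * ∑ j ∈ Finset.range (N + 2),
        decay α ^ Nat.dist k j *
          ∫⁻ x, ‖martingaleDifference μ (grid u δ) f N j x‖ₑ ^ 2 ∂μ := by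
  have measurable_paraproduct : Measurable fun x =>
      ‖successiveAverage μ (grid u δ) f (k + 1) x‖ₑ ^ 2 * ‖theta μ s t 1 x‖ₑ ^ 2 :=
    ((measurable_successiveAverage (measurable_grid u δ) hfm (k + 1)).enorm.pow_const 2).mul
      ((hs.measurable_theta measurable_one t).enorm.pow_const 2)
  calc ∫⁻ x in {x | IsGood u δ N k x}, ‖theta μ s t f x‖ₑ ^ 2 ∂μ
      ≤ ∫⁻ x in {x | IsGood u δ N k x},
        (2 * (‖successiveAverage μ (grid u δ) f (k + 1) x‖ₑ ^ 2 * ‖theta μ s t 1 x‖ₑ ^ 2) +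
          2 * ‖∑ j ∈ Finset.range (N + 2), levelError μ s u δ N k t f j x‖ₑ ^ 2) ∂μ := by
        refine lintegral_mono fun x => ?_
        rw [hs.theta_eq_add_sum_levelError (u := u) hα hδ hk (pos_of_mem_levelInterval hδ ht) hf x,
          ← mul_pow, ← enorm_mul, ← mul_add]
        exact (pow_le_pow_left' (enorm_add_le _ _) 2).trans (ennreal_add_sq_le _ _)
    _ = 2 * ∫⁻ x in {x | IsGood u δ N k x},
          ‖successiveAverage μ (grid u δ) f (k + 1) x‖ₑ ^ 2 * ‖theta μ s t 1 x‖ₑ ^ 2 ∂μ +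
        2 * ∫⁻ x in {x | IsGood u δ N k x},
          ‖∑ j ∈ Finset.range (N + 2), levelError μ s u δ N k t f j x‖ₑ ^ 2 ∂μ := by
        rw [lintegral_add_left (measurable_paraproduct.const_mul 2),
          lintegral_const_mul _ measurable_paraproduct, lintegral_const_mul' _ _ (by simp)]
    _ ≤ _ := by
        refine add_le_add le_rfl ((mul_le_mul_right
          (hs.setLIntegral_sum_levelError_sq_le hα hδ hk ht hfm hf) 2).trans_eq ?_)
        simp only [Finset.mul_sum]
        exact Finset.sum_congr rfl fun j _ => by ring

end IsMajorized

end Levels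

section Scales

/-- The measure `dt / t` on the scales `t > 0`. -/
noncomputable def scaleMeasure : Measure ℝ :=
  volume.withDensity fun t => ENNReal.ofReal (1 / t)

instance : SFinite scaleMeasure := by
  rw [scaleMeasure]
  infer_instance

theorem scaleMeasure_levelInterval_le_one {δ : ℝ} (hδ : 0 < δ) (k : ℕ) :
    scaleMeasure (levelInterval δ k) ≤ 1 := by
  have mesh_pos : 0 < δ * 2 ^ k / 4 := by positivity
  rw [scaleMeasure, withDensity_apply (s := levelInterval δ k) _ measurableSet_Ico]
  calc ∫⁻ t in levelInterval δ k, ENNReal.ofReal (1 / t)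
      ≤ ∫⁻ _ in levelInterval δ k, ENNReal.ofReal (1 / (δ * 2 ^ k / 4)) :=
        setLIntegral_mono measurable_const fun t ht =>
          ENNReal.ofReal_le_ofReal (one_div_le_one_div_of_le mesh_pos ht.1)
    _ = 1 := by
        rw [setLIntegral_const, levelInterval, Real.volume_Ico,
          ← ENNReal.ofReal_mul (by positivity)]
        convert ENNReal.ofReal_one using 2
        field_simp
        ring

theorem sum_setLIntegral_levelInterval {δ : ℝ} (hδ : 0 < δ) (ν : Measure ℝ) (Φ : ℝ → ℝ≥0∞)
    (m : ℕ) :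
    ∑ k ∈ Finset.range m, ∫⁻ t in levelInterval δ k, Φ t ∂ν =
      ∫⁻ t in Set.Ico (δ / 4) (δ * 2 ^ m / 4), Φ t ∂ν := by
  induction m with
  | zero => simp
  | succ m ih =>
    have next_level : levelInterval δ m = Set.Ico (δ * 2 ^ m / 4) (δ * 2 ^ (m + 1) / 4) := by
      rw [levelInterval, pow_succ]
      congr 1
      ring
    have lower_le : δ / 4 ≤ δ * 2 ^ m / 4 := by
      gcongr
      exact le_mul_of_one_le_right hδ.le (one_le_pow₀ one_le_two)
    have le_upper : δ * 2 ^ m / 4 ≤ δ * 2 ^ (m + 1) / 4 := by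
      gcongr
      exacts [one_le_two, m.le_succ]
    rw [Finset.sum_range_succ, ih, next_level, ← Set.Ico_union_Ico_eq_Ico lower_le le_upper,
      lintegral_union measurableSet_Ico Set.Ico_disjoint_Ico_same]

variable {n : ℕ} {μ : Measure (Space n)} {𝕜 : Type*} [RCLike 𝕜] {α : ℝ} {C : ℝ≥0}
  {s : ℝ → Space n → Space n → 𝕜}

/-- The square function `∫_I |θ_t g(x)|² dt/t`, localized to the scales in `I`. -/
noncomputable def squareDensity (μ : Measure (Space n)) (s : ℝ → Space n → Space n → 𝕜)
    (I : Set ℝ) (g : Space n → 𝕜) (x : Space n) : ℝ≥0∞ :=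
  ∫⁻ t in I, ‖theta μ s t g x‖ₑ ^ 2 ∂scaleMeasure

theorem squareIntegral_eq_setLIntegral_scaleMeasure (A : Set (Space n)) {I : Set ℝ}
    (hI : MeasurableSet I) (g : Space n → 𝕜) :
    squareIntegral μ s A I g =
      ∫⁻ t in I, ∫⁻ x in A, ‖theta μ s t g x‖ₑ ^ 2 ∂μ ∂scaleMeasure := by
  rw [scaleMeasure, setLIntegral_withDensity_eq_setLIntegral_mul_non_measurable _ (by fun_prop) _
    hI (Filter.Eventually.of_forall fun _ => ENNReal.ofReal_lt_top)]
  simp only [squareIntegral, Pi.mul_apply, mul_comm]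

theorem sum_squareDensity_levelInterval {δ : ℝ} (hδ : 0 < δ) (g : Space n → 𝕜) (m : ℕ)
    (x : Space n) :
    ∑ k ∈ Finset.range m, squareDensity μ s (levelInterval δ k) g x =
      squareDensity μ s (Set.Ico (δ / 4) (δ * 2 ^ m / 4)) g x :=
  sum_setLIntegral_levelInterval hδ _ _ m

namespace IsMajorized

variable [SFinite μ]

theorem measurable_squareDensity (hs : IsMajorized μ α C s) {g : Space n → 𝕜} (hg : Measurable g)
    (I : Set ℝ) : Measurable (squareDensity μ s I g) :=
  ((hs.measurable_theta_uncurry hg).enorm.pow_const 2).lintegral_prod_left'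

theorem setLIntegral_mul_squareDensity (hs : IsMajorized μ α C s) {g : Space n → 𝕜}
    (hg : Measurable g) {φ : Space n → ℝ≥0∞} (hφ : Measurable φ) (A : Set (Space n)) (I : Set ℝ) :
    ∫⁻ x in A, φ x * squareDensity μ s I g x ∂μ =
      ∫⁻ t in I, ∫⁻ x in A, φ x * ‖theta μ s t g x‖ₑ ^ 2 ∂μ ∂scaleMeasure := by
  have measurable_theta_swap : Measurable fun p : Space n × ℝ => ‖theta μ s p.2 g p.1‖ₑ ^ 2 :=
    ((hs.measurable_theta_uncurry hg).comp measurable_swap).enorm.pow_const 2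
  rw [← lintegral_lintegral_swap
    ((hφ.comp measurable_fst).mul measurable_theta_swap).aemeasurable]
  exact lintegral_congr fun x =>
    (lintegral_const_mul _ (measurable_theta_swap.comp measurable_prodMk_left)).symm

theorem setLIntegral_squareDensity (hs : IsMajorized μ α C s) {g : Space n → 𝕜}
    (hg : Measurable g) (A : Set (Space n)) {I : Set ℝ} (hI : MeasurableSet I) :
    ∫⁻ x in A, squareDensity μ s I g x ∂μ = squareIntegral μ s A I g := by
  simpa only [squareIntegral_eq_setLIntegral_scaleMeasure A hI, Pi.one_apply, one_mul] using
    hs.setLIntegral_mul_squareDensity hg measurable_one A I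

end IsMajorized

end Scales

section Carleson

variable {n : ℕ} {μ : Measure (Space n)} {𝕜 : Type*} [RCLike 𝕜] {α δ : ℝ} {C : ℝ≥0}
  {s : ℝ → Space n → Space n → 𝕜} {u : Space n}

/-- The testing condition: the operators satisfy the square function estimate over the Carleson box
of each cube when applied to the characteristic function of that cube. -/
def HasTestingBound (μ : Measure (Space n)) (s : ℝ → Space n → Space n → 𝕜) (T : ℝ≥0) : Prop :=
  ∀ (c : Space n) (ℓ : ℝ), 0 < ℓ →
    squareIntegral μ s (cube c ℓ) (Set.Ioo 0 ℓ) ((cube c ℓ).indicator 1) ≤ T * μ (cube c ℓ)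

/-- The part at level `k` of the Carleson measure `|θ_t 1(x)|² dμ(x) dt/t`, restricted to the good
points. -/
noncomputable def carlesonWeight (μ : Measure (Space n)) (s : ℝ → Space n → Space n → 𝕜)
    (u : Space n) (δ : ℝ) (N k : ℕ) : Space n → ℝ≥0∞ :=
  {x | IsGood u δ N k x}.indicator (squareDensity μ s (levelInterval δ k) 1)

/-- The packing constant of the weights `carlesonWeight`. The summand `1` only serves to make it
nonzero. -/
noncomputable def carlesonConst (n : ℕ) (α : ℝ) (C T : ℝ≥0) : ℝ≥0 :=
  1 + 2 * T + 2 * offDiagConst n α C ^ 2 * decaySum α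

/-- The cube concentric with the grid cube of index `c` and level `i` which contains definite
neighbourhoods of all the good points of the latter. -/
noncomputable def innerCube (u : Space n) (δ : ℝ) (i : ℕ) (c : Fin n → ℤ) : Set (Space n) :=
  cube (gridCenter u (δ * 2 ^ i) c) ((1 - margin n 0 i) * (δ * 2 ^ i))

theorem measurableSet_innerCube (u : Space n) (δ : ℝ) (i : ℕ) (c : Fin n → ℤ) :
    MeasurableSet (innerCube u δ i c) :=
  Metric.isClosed_closedBall.measurableSet

theorem innerCube_subset (u : Space n) (hδ : 0 < δ) (i : ℕ) (c : Fin n → ℤ) :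
    innerCube u δ i c ⊆ grid u δ i ⁻¹' {c} := fun y hy => by
  have mesh_pos : 0 < δ * 2 ^ i := by positivity
  have margin_mul_pos := mul_pos (margin_pos n 0 i) mesh_pos
  refine gridIndex_eq_of_dist_lt u mesh_pos (lt_of_le_of_lt hy ?_)
  linarith

theorem ball_subset_innerCube (hδ : 0 < δ) {N k i : ℕ} (hi : i ∈ Finset.Icc k N) {x : Space n}
    (hx : IsGood u δ N k x) :
    Metric.ball x (margin n k i * (δ * 2 ^ i) / 2) ⊆ innerCube u δ i (grid u δ i x) := by
  have margin_le : margin n 0 i ≤ margin n k i := by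
    rw [margin, margin]
    gcongr ?_ * ?_
    exact pow_le_pow_of_le_one (by norm_num) (by norm_num) (by omega)
  have margin_mul_le : margin n 0 i * (δ * 2 ^ i) ≤ margin n k i * (δ * 2 ^ i) := by gcongr
  refine ((hx i hi).ball_subset (ρ := margin n 0 i * (δ * 2 ^ i) / 2) (by linarith)).trans_eq ?_
  rw [innerCube, cube, grid]
  congr 1
  ring

namespace IsMajorized

variable [SFinite μ]

theorem enorm_theta_one_sq_le (hs : IsMajorized μ α C s) (hα : 0 < α) (hδ : 0 < δ) {N k i : ℕ}
    (hi : i ∈ Finset.Icc k N) {t : ℝ} (ht : t ∈ levelInterval δ k) {x : Space n}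
    (hx : IsGood u δ N k x) :
    ‖theta μ s t 1 x‖ₑ ^ 2 ≤
      2 * ‖theta μ s t ((innerCube u δ i (grid u δ i x)).indicator 1) x‖ₑ ^ 2 +
        2 * offDiagConst n α C ^ 2 * decay α ^ (i - k) := by
  set χ : Space n → 𝕜 := (innerCube u δ i (grid u δ i x)).indicator 1
  have t_pos := pos_of_mem_levelInterval hδ ht
  have radius_pos : 0 < margin n k i * (δ * 2 ^ i) / 2 := by
    have := margin_pos n k i
    positivity
  have far_part_le : ‖theta μ s t 1 x - theta μ s t χ x‖ₑ ≤
      offDiagConst n α C * decay α ^ (i - k) := by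
    refine (hs.enorm_theta_one_sub_le hα t_pos radius_pos (measurableSet_innerCube u δ i _)
      (ball_subset_innerCube hδ hi hx)).trans
        (mul_ofReal_rpow_mul_majorantBound_le hα C (by positivity) ?_)
    rw [div_div_eq_mul_div, mul_div_right_comm]
    linarith [div_margin_mul_le n hδ (Finset.mem_Icc.1 hi).1 ht]
  calc ‖theta μ s t 1 x‖ₑ ^ 2
      = ‖theta μ s t χ x + (theta μ s t 1 x - theta μ s t χ x)‖ₑ ^ 2 := by rw [add_sub_cancel]
    _ ≤ 2 * (‖theta μ s t χ x‖ₑ ^ 2 + ‖theta μ s t 1 x - theta μ s t χ x‖ₑ ^ 2) :=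
        (pow_le_pow_left' (enorm_add_le _ _) 2).trans (ennreal_add_sq_le _ _)
    _ ≤ 2 * (‖theta μ s t χ x‖ₑ ^ 2 +
          offDiagConst n α C ^ 2 * (decay α ^ (i - k) * decay α ^ (i - k))) := by
        rw [← sq, ← mul_pow]
        gcongr
    _ ≤ 2 * (‖theta μ s t χ x‖ₑ ^ 2 + offDiagConst n α C ^ 2 * (decay α ^ (i - k) * 1)) := by
        gcongr
        exact pow_le_one' (mod_cast (decay_lt_one hα).le) _
    _ = 2 * ‖theta μ s t χ x‖ₑ ^ 2 + 2 * offDiagConst n α C ^ 2 * decay α ^ (i - k) := by ring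

theorem squareDensity_one_le (hs : IsMajorized μ α C s) (hα : 0 < α) (hδ : 0 < δ) {N k i : ℕ}
    (hi : i ∈ Finset.Icc k N) {x : Space n} (hx : IsGood u δ N k x) :
    squareDensity μ s (levelInterval δ k) 1 x ≤
      2 * squareDensity μ s (levelInterval δ k)
          ((innerCube u δ i (grid u δ i x)).indicator 1) x +
        2 * offDiagConst n α C ^ 2 * decay α ^ (i - k) := by
  calc squareDensity μ s (levelInterval δ k) 1 x
      ≤ ∫⁻ t in levelInterval δ k,
          (2 * ‖theta μ s t ((innerCube u δ i (grid u δ i x)).indicator 1) x‖ₑ ^ 2 +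
            2 * offDiagConst n α C ^ 2 * decay α ^ (i - k)) ∂scaleMeasure :=
        setLIntegral_mono' measurableSet_Ico fun t ht =>
          hs.enorm_theta_one_sq_le hα hδ hi ht hx
    _ ≤ _ := by
        rw [lintegral_add_right _ measurable_const, lintegral_const_mul' _ _ (by simp),
          setLIntegral_const]
        exact add_le_add le_rfl
          (mul_le_of_le_one_right' (scaleMeasure_levelInterval_le_one hδ k))

theorem measurable_carlesonWeight (hs : IsMajorized μ α C s) (u : Space n) (δ : ℝ) (N k : ℕ) :
    Measurable (carlesonWeight μ s u δ N k) :=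
  (hs.measurable_squareDensity measurable_one _).indicator (measurableSet_isGood u δ N k)

theorem setLIntegral_carlesonWeight_le (hs : IsMajorized μ α C s) (hα : 0 < α) (hδ : 0 < δ)
    {N k i : ℕ} (hi : i ∈ Finset.Icc k N) (c : Fin n → ℤ) :
    ∫⁻ x in grid u δ i ⁻¹' {c}, carlesonWeight μ s u δ N k x ∂μ ≤
      2 * ∫⁻ x in innerCube u δ i c,
          squareDensity μ s (levelInterval δ k) ((innerCube u δ i c).indicator 1) x ∂μ +
        2 * offDiagConst n α C ^ 2 * decay α ^ Nat.dist i k * μ (grid u δ i ⁻¹' {c}) := by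
  set G := {x | IsGood u δ N k x}
  set Q := grid u δ i ⁻¹' {c}
  have measurableSet_Q : MeasurableSet Q := measurable_grid u δ i (measurableSet_singleton c)
  have good_subset : G ∩ Q ⊆ innerCube u δ i c := fun x ⟨good, hx⟩ => by
    have radius_pos : 0 < margin n k i * (δ * 2 ^ i) / 2 := by
      have := margin_pos n k i
      positivity
    rw [← show grid u δ i x = c from hx]
    exact ball_subset_innerCube hδ hi good (Metric.mem_ball_self radius_pos)
  calc ∫⁻ x in Q, carlesonWeight μ s u δ N k x ∂μ
      = ∫⁻ x in G ∩ Q, squareDensity μ s (levelInterval δ k) 1 x ∂μ :=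
        setLIntegral_indicator (measurableSet_isGood u δ N k) _
    _ ≤ ∫⁻ x in G ∩ Q, (2 * squareDensity μ s (levelInterval δ k)
          ((innerCube u δ i c).indicator 1) x +
            2 * offDiagConst n α C ^ 2 * decay α ^ (i - k)) ∂μ := by
        refine setLIntegral_mono' ((measurableSet_isGood u δ N k).inter measurableSet_Q)
          fun x hx => ?_
        rw [← show grid u δ i x = c from hx.2]
        exact hs.squareDensity_one_le hα hδ hi hx.1
    _ = 2 * ∫⁻ x in G ∩ Q, squareDensity μ s (levelInterval δ k)
          ((innerCube u δ i c).indicator 1) x ∂μ +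
            2 * offDiagConst n α C ^ 2 * decay α ^ (i - k) * μ (G ∩ Q) := by
        rw [lintegral_add_right _ measurable_const, lintegral_const_mul' _ _ (by simp),
          setLIntegral_const]
    _ ≤ _ := by
        rw [Nat.dist_eq_sub_of_le_right (Finset.mem_Icc.1 hi).1]
        gcongr
        exact Set.inter_subset_right

theorem sum_setLIntegral_innerCube_le (hs : IsMajorized μ α C s) (hδ : 0 < δ) {T : ℝ≥0}
    (hT : HasTestingBound μ s T) (i : ℕ) (c : Fin n → ℤ) :
    ∑ k ∈ Finset.range (i + 1), ∫⁻ x in innerCube u δ i c,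
        squareDensity μ s (levelInterval δ k) ((innerCube u δ i c).indicator 1) x ∂μ ≤
      T * μ (grid u δ i ⁻¹' {c}) := by
  have measurable_indicator : Measurable ((innerCube u δ i c).indicator (1 : Space n → 𝕜)) :=
    measurable_one.indicator (measurableSet_innerCube u δ i c)
  have mesh_pos : 0 < δ * 2 ^ i := by positivity
  have half_mesh_le : δ * 2 ^ i / 2 ≤ (1 - margin n 0 i) * (δ * 2 ^ i) := by
    have := mul_le_mul_of_nonneg_right (margin_le_half n 0 i) mesh_pos.le
    linarith
  rw [← lintegral_finsetSum _ fun k _ => hs.measurable_squareDensity measurable_indicator _]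
  simp only [sum_squareDensity_levelInterval hδ]
  rw [hs.setLIntegral_squareDensity measurable_indicator _ measurableSet_Ico]
  refine (lintegral_mono_set fun t ht => ?_).trans ((hT _ _ (by linarith)).trans
    (mul_le_mul' le_rfl (measure_mono (innerCube_subset u hδ i c))))
  refine ⟨lt_of_lt_of_le (by positivity) ht.1, (ht.2.trans_le ?_).trans_le half_mesh_le⟩
  exact le_of_eq (by ring)

theorem carleson_packing (hs : IsMajorized μ α C s) (hα : 0 < α) (hδ : 0 < δ) {T : ℝ≥0}
    (hT : HasTestingBound μ s T) {N i : ℕ} (hi : i ≤ N) (c : Fin n → ℤ) :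
    ∫⁻ x in grid u δ i ⁻¹' {c}, ∑ k ∈ Finset.range (i + 1), carlesonWeight μ s u δ N k x ∂μ ≤
      carlesonConst n α C T * μ (grid u δ i ⁻¹' {c}) := by
  rw [lintegral_finsetSum _ fun k _ => hs.measurable_carlesonWeight u δ N k]
  refine (Finset.sum_le_sum fun k hk => hs.setLIntegral_carlesonWeight_le (N := N) hα hδ
    (Finset.mem_Icc.2 ⟨Nat.lt_succ_iff.1 (Finset.mem_range.1 hk), hi⟩) c).trans ?_
  rw [Finset.sum_add_distrib, ← Finset.mul_sum, ← Finset.sum_mul, ← Finset.mul_sum]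
  calc _ ≤ 2 * (T * μ (grid u δ i ⁻¹' {c})) +
        2 * offDiagConst n α C ^ 2 * decaySum α * μ (grid u δ i ⁻¹' {c}) := by
        refine add_le_add (mul_le_mul' le_rfl (hs.sum_setLIntegral_innerCube_le hδ hT i c)) ?_
        gcongr
        exact sum_range_decay_pow_dist_le hα i (i + 1)
    _ = (2 * T + 2 * offDiagConst n α C ^ 2 * decaySum α) * μ (grid u δ i ⁻¹' {c}) := by ring
    _ ≤ carlesonConst n α C T * μ (grid u δ i ⁻¹' {c}) := by
        gcongr
        rw [carlesonConst, add_assoc 1]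
        push_cast
        exact le_add_self

end IsMajorized

end Carleson

section RandomGrids

variable {Ω X : Type*} [MeasurableSpace Ω] [MeasurableSpace X] {μ : Measure X} [SFinite μ]
  {P : Measure Ω} {G : Set (Ω × X)} {Φ : X → ℝ≥0∞}

theorem measurable_setLIntegral_section (hG : MeasurableSet G) (hΦ : Measurable Φ) :
    Measurable fun ω => ∫⁻ x in Prod.mk ω ⁻¹' G, Φ x ∂μ := by
  simp only [← lintegral_indicator (measurable_prodMk_left hG)]
  exact ((hΦ.comp measurable_snd).indicator hG).lintegral_prod_right'

theorem lintegral_le_two_mul_lintegral_setLIntegral_section [SFinite P] (hG : MeasurableSet G)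
    (hΦ : Measurable Φ) (hP : ∀ x, 1 / 2 ≤ P {ω | (ω, x) ∈ G}) :
    ∫⁻ x, Φ x ∂μ ≤ 2 * ∫⁻ ω, ∫⁻ x in Prod.mk ω ⁻¹' G, Φ x ∂μ ∂P := by
  calc ∫⁻ x, Φ x ∂μ = 2 * ∫⁻ x, Φ x * (1 / 2) ∂μ := by
        rw [lintegral_mul_const _ hΦ, mul_left_comm, one_div,
          ENNReal.mul_inv_cancel two_ne_zero (by simp), mul_one]
    _ ≤ 2 * ∫⁻ x, Φ x * P {ω | (ω, x) ∈ G} ∂μ := by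
        gcongr with x
        exact hP x
    _ = 2 * ∫⁻ x, ∫⁻ ω, G.indicator (fun p => Φ p.2) (ω, x) ∂P ∂μ := by
        congr 1
        refine lintegral_congr fun x => ?_
        have measurable_section : MeasurableSet {ω | (ω, x) ∈ G} := measurable_prodMk_right hG
        rw [← setLIntegral_const, ← lintegral_indicator measurable_section]
        rfl
    _ = 2 * ∫⁻ ω, ∫⁻ x in Prod.mk ω ⁻¹' G, Φ x ∂μ ∂P := by
        rw [← lintegral_lintegral_swap (f := fun ω x => G.indicator (fun p => Φ p.2) (ω, x))
          ((hΦ.comp measurable_snd).indicator hG).aemeasurable]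
        simp only [← lintegral_indicator (measurable_prodMk_left hG)]
        rfl

end RandomGrids

section SquareFunctionEstimate

theorem half_pow_mul_two_pow (p : ℕ) : (1 / 2 : ℝ) ^ p * 2 ^ (2 * p + 1) = 2 ^ (p + 1) := by
  rw [two_mul, add_assoc, pow_add 2 p, ← mul_assoc, ← mul_pow]
  norm_num

theorem monotone_Ico_half_pow_two_pow :
    Monotone fun p : ℕ => Set.Ico ((1 / 2 : ℝ) ^ p / 4) (2 ^ (p + 1) / 4) := by
  intro p q hpq
  refine Set.Ico_subset_Ico ?_ ?_
  · exact div_le_div_of_nonneg_right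
      (pow_le_pow_of_le_one (by norm_num) (by norm_num) hpq) zero_le_four
  · gcongr
    norm_num

theorem iUnion_Ico_half_pow_two_pow :
    ⋃ p : ℕ, Set.Ico ((1 / 2 : ℝ) ^ p / 4) (2 ^ (p + 1) / 4) = Set.Ioi 0 := by
  refine Set.Subset.antisymm (Set.iUnion_subset fun p t ht => lt_of_lt_of_le (by positivity) ht.1)
    fun t t_pos => Set.mem_iUnion.2 ?_
  obtain ⟨p, hp⟩ := exists_pow_lt_of_lt_one (Set.mem_Ioi.1 t_pos) (by norm_num : (1 / 2 : ℝ) < 1)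
  obtain ⟨q, hq⟩ := pow_unbounded_of_one_lt (4 * t) one_lt_two
  have half_pow_le : (1 / 2 : ℝ) ^ max p q ≤ (1 / 2) ^ p :=
    pow_le_pow_of_le_one (by norm_num) (by norm_num) (le_max_left p q)
  have le_two_pow : (2 : ℝ) ^ q ≤ 2 ^ (max p q + 1) :=
    pow_le_pow_right₀ one_le_two ((le_max_right p q).trans (Nat.le_succ _))
  refine ⟨max p q, ?_, ?_⟩
  · have := pow_pos (one_half_pos (α := ℝ)) (max p q)
    linarith
  · linarith

variable {n : ℕ} {μ : Measure (Space n)} {𝕜 : Type*} [RCLike 𝕜] {α δ : ℝ} {C T : ℝ≥0}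
  {s : ℝ → Space n → Space n → 𝕜}

/-- The constant of the square function estimate restricted to the good points. -/
noncomputable def goodConst (n : ℕ) (α : ℝ) (C T : ℝ≥0) : ℝ≥0 :=
  8 * carlesonConst n α C T + 8 * offDiagConst n α C ^ 2 * decaySum α ^ 2

theorem theta_congr_ae (s : ℝ → Space n → Space n → 𝕜) {f g : Space n → 𝕜} (h : f =ᵐ[μ] g) (t : ℝ)
    (x : Space n) : theta μ s t f x = theta μ s t g x :=
  integral_congr_ae (by filter_upwards [h] with y hy; rw [hy])

theorem squareIntegral_congr_kernel {s' : ℝ → Space n → Space n → 𝕜} (A : Set (Space n))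
    {I : Set ℝ} (hI : MeasurableSet I) (h : ∀ t ∈ I, s t = s' t) (f : Space n → 𝕜) :
    squareIntegral μ s A I f = squareIntegral μ s' A I f := by
  refine setLIntegral_congr_fun hI fun t ht => ?_
  simp only [theta, h t ht]

theorem IsUpperDoubling.isFiniteMeasureOnCompacts {lam : Space n → ℝ → ℝ} {Cl : ℝ}
    (h : IsUpperDoubling μ lam Cl) : IsFiniteMeasureOnCompacts μ := by
  have : IsLocallyFiniteMeasure μ := ⟨fun x => ⟨Metric.ball x 1, Metric.ball_mem_nhds x one_pos,
    (h.measure_ball_le x 1 one_pos).trans_lt ENNReal.ofReal_lt_top⟩⟩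
  infer_instance

namespace IsMajorized

variable [IsFiniteMeasureOnCompacts μ]

theorem packingAverage_carlesonWeight_le (hs : IsMajorized μ α C s) (hα : 0 < α) (hδ : 0 < δ)
    (hT : HasTestingBound μ s T) (u : Space n) {N i : ℕ} (hi : i ≤ N + 1) (x : Space n) :
    packingAverage μ (grid u δ)
      (fun k x => (carlesonConst n α C T : ℝ≥0∞)⁻¹ * carlesonWeight μ s u δ N k x) i x ≤ 1 := by
  cases i with
  | zero => exact zero_le_one
  | succ i =>
    have const_ne_zero : (carlesonConst n α C T : ℝ≥0∞) ≠ 0 := by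
      simp [carlesonConst, add_assoc]
    rw [packingAverage, fiberLAverage, setLAverage_eq]
    refine ENNReal.div_le_of_le_mul ?_
    simp only [← Finset.mul_sum]
    rw [lintegral_const_mul' _ _ (ENNReal.inv_ne_top.2 const_ne_zero), one_mul]
    refine (mul_le_mul' le_rfl
      (hs.carleson_packing hα hδ hT (Nat.le_of_succ_le_succ hi) (grid u δ i x))).trans_eq ?_
    rw [← mul_assoc, ENNReal.inv_mul_cancel const_ne_zero ENNReal.coe_ne_top, one_mul]

theorem sum_paraproduct_le (hs : IsMajorized μ α C s) (hα : 0 < α) (hδ : 0 < δ)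
    (hT : HasTestingBound μ s T) (u : Space n) (N : ℕ) {f : Space n → 𝕜} (hf : Measurable f) :
    ∑ k ∈ Finset.range (N + 1), ∫⁻ x,
        ‖successiveAverage μ (grid u δ) f (k + 1) x‖ₑ ^ 2 * carlesonWeight μ s u δ N k x ∂μ ≤
      4 * carlesonConst n α C T * ∫⁻ x, ‖f x‖ₑ ^ 2 ∂μ := by
  set D : ℝ≥0∞ := ↑(carlesonConst n α C T)
  have D_ne_zero : D ≠ 0 := by simp [D, carlesonConst, add_assoc]
  have D_ne_top : D ≠ ∞ := ENNReal.coe_ne_top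
  calc _ ≤ ∑ k ∈ Finset.range (N + 1), D * ∫⁻ x,
        successiveLAverage μ (grid u δ) (fun y => ‖f y‖ₑ) (k + 1) x ^ 2 *
          (D⁻¹ * carlesonWeight μ s u δ N k x) ∂μ := by
        refine Finset.sum_le_sum fun k _ => ?_
        rw [← lintegral_const_mul' _ _ D_ne_top]
        refine lintegral_mono fun x => ?_
        rw [mul_left_comm, ← mul_assoc D, ENNReal.mul_inv_cancel D_ne_zero D_ne_top, one_mul]
        gcongr
        exact enorm_successiveAverage_le f (k + 1) x
    _ ≤ D * (4 * ∫⁻ x, ‖f x‖ₑ ^ 2 ∂μ) := by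
        rw [← Finset.mul_sum]
        gcongr
        exact carleson_embedding (r := fun _ => parentIndex)
          (w := fun k x => D⁻¹ * carlesonWeight μ s u δ N k x) (measurable_grid u δ)
          (measure_grid_ne_top μ u hδ) (grid_succ u δ)
          (fun k => (hs.measurable_carlesonWeight u δ N k).const_mul _)
          (fun i hi => hs.packingAverage_carlesonWeight_le hα hδ hT u hi) hf.enorm
    _ = _ := by ring

theorem setLIntegral_isGood_squareDensity_le (hs : IsMajorized μ α C s) (hα : 0 < α) (hδ : 0 < δ)
    (u : Space n) {N k : ℕ} (hk : k ≤ N) {f : Space n → 𝕜} (hfm : Measurable f)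
    (hf : MemLp f 2 μ) :
    ∫⁻ x in {x | IsGood u δ N k x}, squareDensity μ s (levelInterval δ k) f x ∂μ ≤
      2 * ∫⁻ x,
          ‖successiveAverage μ (grid u δ) f (k + 1) x‖ₑ ^ 2 * carlesonWeight μ s u δ N k x ∂μ +
        8 * offDiagConst n α C ^ 2 * decaySum α * ∑ j ∈ Finset.range (N + 2),
          decay α ^ Nat.dist k j *
            ∫⁻ x, ‖martingaleDifference μ (grid u δ) f N j x‖ₑ ^ 2 ∂μ := by
  have measurable_average : Measurable fun x =>
      ‖successiveAverage μ (grid u δ) f (k + 1) x‖ₑ ^ 2 :=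
    (measurable_successiveAverage (measurable_grid u δ) hfm (k + 1)).enorm.pow_const 2
  have weight_eq : ∫⁻ x, ‖successiveAverage μ (grid u δ) f (k + 1) x‖ₑ ^ 2 *
      carlesonWeight μ s u δ N k x ∂μ = ∫⁻ t in levelInterval δ k,
        ∫⁻ x in {x | IsGood u δ N k x}, ‖successiveAverage μ (grid u δ) f (k + 1) x‖ₑ ^ 2 *
          ‖theta μ s t 1 x‖ₑ ^ 2 ∂μ ∂scaleMeasure := by
    rw [← hs.setLIntegral_mul_squareDensity measurable_one measurable_average,
      ← lintegral_indicator (measurableSet_isGood u δ N k)]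
    simp only [carlesonWeight, Set.indicator_mul_right]
  rw [hs.setLIntegral_squareDensity (I := levelInterval δ k) hfm _ measurableSet_Ico,
    squareIntegral_eq_setLIntegral_scaleMeasure (I := levelInterval δ k) _ measurableSet_Ico,
    weight_eq]
  refine (setLIntegral_mono' measurableSet_Ico fun t ht =>
    hs.setLIntegral_theta_sq_le hα hδ hk ht hfm hf).trans ?_
  rw [lintegral_add_right _ measurable_const, lintegral_const_mul' _ _ (by simp),
    setLIntegral_const]
  exact add_le_add le_rfl (mul_le_of_le_one_right' (scaleMeasure_levelInterval_le_one hδ k))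

theorem sum_setLIntegral_isGood_squareDensity_le (hs : IsMajorized μ α C s) (hα : 0 < α)
    (hδ : 0 < δ) (hT : HasTestingBound μ s T) (u : Space n) (N : ℕ) {f : Space n → 𝕜}
    (hfm : Measurable f) (hf : MemLp f 2 μ) :
    ∑ k ∈ Finset.range (N + 1),
        ∫⁻ x in {x | IsGood u δ N k x}, squareDensity μ s (levelInterval δ k) f x ∂μ ≤
      goodConst n α C T * ∫⁻ x, ‖f x‖ₑ ^ 2 ∂μ := by
  set H : ℕ → ℝ≥0∞ := fun j => ∫⁻ x, ‖martingaleDifference μ (grid u δ) f N j x‖ₑ ^ 2 ∂μ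
  have sum_H : ∑ j ∈ Finset.range (N + 2), H j = ∫⁻ x, ‖f x‖ₑ ^ 2 ∂μ :=
    sum_lintegral_martingaleDifference_sq (measurable_grid u δ) (measure_grid_ne_top μ u hδ) hf N
  have interaction_le : ∑ k ∈ Finset.range (N + 1), ∑ j ∈ Finset.range (N + 2),
      decay α ^ Nat.dist k j * H j ≤ decaySum α * ∫⁻ x, ‖f x‖ₑ ^ 2 ∂μ := by
    rw [Finset.sum_comm, ← sum_H, Finset.mul_sum]
    refine Finset.sum_le_sum fun j _ => ?_
    simp only [← Finset.sum_mul, Nat.dist_comm _ j]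
    gcongr
    exact sum_range_decay_pow_dist_le hα j (N + 1)
  refine (Finset.sum_le_sum fun k hk => hs.setLIntegral_isGood_squareDensity_le hα hδ u
    (Nat.lt_succ_iff.1 (Finset.mem_range.1 hk)) hfm hf).trans ?_
  rw [Finset.sum_add_distrib, ← Finset.mul_sum, ← Finset.mul_sum]
  refine (add_le_add (mul_le_mul' le_rfl (hs.sum_paraproduct_le hα hδ hT u N hfm))
    (mul_le_mul' le_rfl interaction_le)).trans_eq ?_
  rw [goodConst]
  push_cast
  ring

theorem squareIntegral_Ico_le (hs : IsMajorized μ α C s) (hα : 0 < α) (hδ : 0 < δ)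
    (hT : HasTestingBound μ s T) (N : ℕ) {f : Space n → 𝕜} (hfm : Measurable f)
    (hf : MemLp f 2 μ) :
    squareIntegral μ s Set.univ (Set.Ico (δ / 4) (δ * 2 ^ (N + 1) / 4)) f ≤
      2 * goodConst n α C T * ∫⁻ x, ‖f x‖ₑ ^ 2 ∂μ := by
  set P := shiftMeasure n (δ * 2 ^ N)
  have : IsProbabilityMeasure P := isProbabilityMeasure_shiftMeasure (by positivity)
  have measurable_density (k : ℕ) := hs.measurable_squareDensity hfm (levelInterval δ k)
  have measurable_good (k : ℕ) : Measurable fun u => ∫⁻ x in {x | IsGood u δ N k x},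
      squareDensity μ s (levelInterval δ k) f x ∂μ :=
    measurable_setLIntegral_section (measurableSet_isGood_prod δ N k) (measurable_density k)
  calc squareIntegral μ s Set.univ (Set.Ico (δ / 4) (δ * 2 ^ (N + 1) / 4)) f
      = ∑ k ∈ Finset.range (N + 1), ∫⁻ x, squareDensity μ s (levelInterval δ k) f x ∂μ := by
        rw [← hs.setLIntegral_squareDensity hfm _ measurableSet_Ico, setLIntegral_univ,
          ← lintegral_finsetSum _ fun k _ => measurable_density k]
        simp only [sum_squareDensity_levelInterval hδ]
    _ ≤ ∑ k ∈ Finset.range (N + 1), 2 * ∫⁻ u, ∫⁻ x in {x | IsGood u δ N k x},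
          squareDensity μ s (levelInterval δ k) f x ∂μ ∂P :=
        Finset.sum_le_sum fun k _ => lintegral_le_two_mul_lintegral_setLIntegral_section
          (measurableSet_isGood_prod δ N k) (measurable_density k)
          (half_le_shiftMeasure_isGood hδ N k)
    _ = 2 * ∫⁻ u, ∑ k ∈ Finset.range (N + 1), ∫⁻ x in {x | IsGood u δ N k x},
          squareDensity μ s (levelInterval δ k) f x ∂μ ∂P := by
        rw [← Finset.mul_sum, lintegral_finsetSum _ fun k _ => measurable_good k]
    _ ≤ 2 * ∫⁻ _, goodConst n α C T * ∫⁻ x, ‖f x‖ₑ ^ 2 ∂μ ∂P := by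
        gcongr with u
        exact hs.sum_setLIntegral_isGood_squareDensity_le hα hδ hT u N hfm hf
    _ = 2 * goodConst n α C T * ∫⁻ x, ‖f x‖ₑ ^ 2 ∂μ := by
        rw [lintegral_const, measure_univ, mul_one, mul_assoc]

theorem squareIntegral_le (hs : IsMajorized μ α C s) (hα : 0 < α) (hT : HasTestingBound μ s T)
    {f : Space n → 𝕜} (hf : MemLp f 2 μ) :
    squareIntegral μ s Set.univ (Set.Ioi 0) f ≤ 2 * goodConst n α C T * eLpNorm f 2 μ ^ 2 := by
  obtain ⟨g, measurable_g, hfg⟩ := hf.aestronglyMeasurable.aemeasurable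
  rw [eLpNorm_congr_ae hfg, eLpNorm_two_sq]
  simp only [squareIntegral, theta_congr_ae s hfg]
  rw [← iUnion_Ico_half_pow_two_pow,
    setLIntegral_iUnion_of_directed _ monotone_Ico_half_pow_two_pow.directed_le]
  refine iSup_le fun p => ?_
  rw [← half_pow_mul_two_pow]
  exact hs.squareIntegral_Ico_le hα (by positivity) hT (2 * p) measurable_g (hf.ae_eq hfg)

end IsMajorized

end SquareFunctionEstimate

end SquareFunction

/-- The constant `C` depends only on `n`, `α`, the doubling constant `Cl`, the kernel constant `K`
and the testing constant `T`. -/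
theorem corollary1p2 (𝕜 : Type*) [RCLike 𝕜] (n : ℕ) (α : ℝ) (hα : 0 < α) (Cl K : ℝ) (T : ℝ≥0) :
    ∃ C : ℝ≥0, ∀ (μ : Measure (SquareFunction.Space n)) (lam : SquareFunction.Space n → ℝ → ℝ)
      (s : ℝ → SquareFunction.Space n → SquareFunction.Space n → 𝕜),
      SquareFunction.IsUpperDoubling μ lam Cl →
      SquareFunction.IsSquareKernel lam α K s →
      (∀ (c : SquareFunction.Space n) (ℓ : ℝ), 0 < ℓ →
        SquareFunction.squareIntegral μ s (SquareFunction.cube c ℓ) (Set.Ioo 0 ℓ)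
          ((SquareFunction.cube c ℓ).indicator 1) ≤ T * μ (SquareFunction.cube c ℓ)) →
      ∀ f : SquareFunction.Space n → 𝕜, MemLp f 2 μ →
        (∀ t, 0 < t → ∀ x, Integrable (fun y => s t x y * f y) μ) ∧
        SquareFunction.squareIntegral μ s Set.univ (Set.Ioi 0) f ≤ C * eLpNorm f 2 μ ^ 2 := by
  open SquareFunction in
  refine ⟨2 * goodConst n α (|K| * dominationConst α Cl).toNNReal T,
    fun μ lam s hμ hs hT f hf => ?_⟩
  have := hμ.isFiniteMeasureOnCompacts
  have hs' := hs.isMajorized hμ hα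
  set s' : ℝ → Space n → Space n → 𝕜 := fun t x y => if 0 < t then s t x y else 0
  have kernel_eq (t : ℝ) (ht : 0 < t) : s t = s' t := by ext x y; simp [s', ht]
  have hT' : HasTestingBound μ s' T := fun c ℓ hℓ => by
    rw [← squareIntegral_congr_kernel _ measurableSet_Ioo fun t ht => kernel_eq t ht.1]
    exact hT c ℓ hℓ
  refine ⟨fun t ht x => ?_, ?_⟩
  · rw [kernel_eq t ht]
    exact hs'.integrable_mul hα ht x hf
  · rw [squareIntegral_congr_kernel _ measurableSet_Ioi kernel_eq]
    exact hs'.squareIntegral_le hα hT' hf
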